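/- Let $n\ge 2$, $p\ge 1$ be integers and $\sigma>0$. Let $X_v=\mu_v+W_v$, $v=1,\dots,n$, where $\mu_v\in\mathbb R^p$ are deterministic and $W_1,\dots,W_n$ are independent $N_p(0,\sigma^2 I)$ vectors. Assume there is exactly one changepoint: an integer $0<\eta<n$ such that, for $0<v<n$, $\mu_v\ne\mu_{v+1}$ if and only if $v=\eta$. Let $\theta=\mu_{\eta+1}-\mu_\eta$, $\phi=\|\theta\|_2$, let $k$ be the number of non-zero entries of $\theta$, and let $\Delta=\min(\eta,n-\eta)$. For $0<v<n$ and $1\le i\le p$, let $$C^v(i)=\frac1\sigma\left[\left(\frac{n-v}{nv}\right)^{1/2}\sum_{t=1}^{v}X_{i,t}-\left(\frac{v}{n(n-v)}\right)^{1/2}\sum_{t=v+1}^{n}X_{i,t}\right],$$ where $X_{i,t}$ is the $i$th entry of $X_t$. For an integer $t\ge1$ let $a(t)=\left\{4\log\left(ep\log n/t^2\right)\right\}^{1/2}$ if $t\le(p\log n)^{1/2}$ and $a(t)=0$ otherwise; let $\nu_a=\mathbb E(Z^2\mid |Z|\ge a)$ for $Z\sim N(0,1)$; and let $$r(t)=\begin{cases}(p\log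 n)^{1/2}&\text{if }t\ge(p\log n)^{1/2},\\ t\log\left(\frac{ep\log n}{t^2}\right)\vee\log n&\text{otherwise,}\end{cases}\qquad h(t)=\begin{cases}\left[p\{\log n\vee\log\log(ep)\}\right]^{1/2}&\text{if }t\ge(p\log n)^{1/2},\\ t\log\left(\frac{ep\log n}{t^2}\right)\vee\log n&\text{otherwise.}\end{cases}$$ Let $\mathcal T=\{1,2,4,\dots,2^{J}\}\cup\{p\}$, where $J=\max\left(0,\lfloor\log_2 (p\log n)^{1/2}\rfloor\right)$. For $\lambda_0>0$ and $\lambda(t)=\lambda_0r(t)$ define $$S^v_\lambda(t)=\sum_{i=1}^p\left\{C^v(i)^2-\nu_{a(t)}\right\}\mathbf 1\{|C^v(i)|\ge a(t)\}-\lambda(t),\qquad S^v_\lambda=\max_{t\in\mathcal T}S^v_\lambda(t),$$ and let $\widehat\eta_\lambda$ be the smallest maximizer of $v\mapsto S^v_\lambda$ over the integers $0<v<n$. There exist universal constants $\lambda_0,C_0,C_1>0$ (not depending on $n$, $p$, $\sigma$, the means or $\eta$) such that, whenever $$\frac{\phi^2\Delta}{\sigma^2}\ge C_0\,h(k),$$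 we have $$\mathbb P\left\{|\widehat\eta_\lambda-\eta|\le C_1\frac{\sigma^2}{\phi^2}h(k)\right\}\ge 1-\frac1n .$$ -/

import Mathlib

open MeasureTheory ProbabilityTheory

noncomputable section

namespace MeanChange

/-! Time points are `1, …, n`; the observation at time `v` is stored at the index `v - 1 : Fin n`. -/

/-- The mean vectors `μ_1, …, μ_n` have exactly one changepoint, located at `η`:
`0 < η < n` and, for `0 < v < n`, `μ_v ≠ μ_{v+1}` if and only if `v = η`. -/
structure IsSingleChangepoint {n p : ℕ} (μ : Fin n → EuclideanSpace ℝ (Fin p)) (η : ℕ) :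
    Prop where
  pos : 0 < η
  lt : η < n
  change_iff : ∀ v : ℕ, 0 < v → ∀ hvn : v < n,
    μ ⟨v - 1, (Nat.sub_le v 1).trans_lt hvn⟩ ≠ μ ⟨v, hvn⟩ ↔ v = η

/-- The change in mean `θ = μ_{η+1} - μ_η` at the changepoint. -/
def IsSingleChangepoint.jump {n p : ℕ} {μ : Fin n → EuclideanSpace ℝ (Fin p)} {η : ℕ}
    (h : IsSingleChangepoint μ η) : EuclideanSpace ℝ (Fin p) :=
  μ ⟨η, h.lt⟩ - μ ⟨η - 1, (Nat.sub_le η 1).trans_lt h.lt⟩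

/-- The number of non-zero entries of a vector. -/
def sparsity {p : ℕ} (θ : EuclideanSpace ℝ (Fin p)) : ℕ :=
  (Finset.univ.filter fun i : Fin p => θ i ≠ 0).card

/-- The CUSUM transformation of `y ∈ ℝ^n` over `(0, n]` at the candidate position `0 < v < n`. -/
def cusum {n : ℕ} (v : ℕ) (y : Fin n → ℝ) : ℝ :=
  √(((n : ℝ) - v) / (n * v)) * ∑ t : Fin n with t.val < v, y t
    - √((v : ℝ) / (n * ((n : ℝ) - v))) * ∑ t : Fin n with v ≤ t.val, y t

/-- The threshold `a(t)`. -/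
def threshold (n p t : ℕ) : ℝ :=
  if (t : ℝ) ≤ √(p * Real.log n) then
    √(4 * Real.log (Real.exp 1 * p * Real.log n / (t : ℝ) ^ 2))
  else 0

/-- The mean-centring term `ν_a = E(Z² | |Z| ≥ a)` for a standard normal `Z`. -/
def centering (a : ℝ) : ℝ :=
  ∫ z, z ^ 2 ∂(cond (gaussianReal 0 1) {z : ℝ | a ≤ |z|})

/-- The function `r(t)` defining the penalty. -/
def penaltyRate (n p t : ℕ) : ℝ :=
  if √(p * Real.log n) ≤ (t : ℝ) then √(p * Real.log n)
  else max (t * Real.log (Real.exp 1 * p * Real.log n / (t : ℝ) ^ 2)) (Real.log n)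

/-- The rate function `h(t)`. -/
def rate (n p t : ℕ) : ℝ :=
  if √(p * Real.log n) ≤ (t : ℝ) then
    √(p * max (Real.log n) (Real.log (Real.log (Real.exp 1 * p))))
  else max (t * Real.log (Real.exp 1 * p * Real.log n / (t : ℝ) ^ 2)) (Real.log n)

/-- The grid of candidate sparsities: the powers of two `1, 2, 4, …` up to `√(p log n)`,
together with `p`. -/
def sparsityGrid (n p : ℕ) : Finset ℕ :=
  insert p ((Finset.range (Nat.log 2 ⌊√(p * Real.log n)⌋₊ + 1)).image fun j => 2 ^ j)

/-- The sparsity-specific penalized score `S_λ^v(t)`, for the penalty function `pen`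
and the data matrix `x`, where `x u i` is coordinate `i` of observation `u`. -/
def sparsityScore {n p : ℕ} (pen : ℕ → ℝ) (x : Fin n → EuclideanSpace ℝ (Fin p)) (v t : ℕ) : ℝ :=
  (∑ i : Fin p,
    if threshold n p t ≤ |cusum v fun u => x u i| then
      (cusum v fun u => x u i) ^ 2 - centering (threshold n p t)
    else 0) - pen t

/-- The penalized score `S_λ^v`, the maximum of `S_λ^v(t)` over the grid. -/
def score {n p : ℕ} (pen : ℕ → ℝ) (x : Fin n → EuclideanSpace ℝ (Fin p)) (v : ℕ) : ℝ :=
  (sparsityGrid n p).sup' (Finset.insert_nonempty _ _) (sparsityScore pen x v)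

/-- The estimated changepoint: the smallest maximizer of the score over `0 < v < n`. -/
def estimator {n p : ℕ} (pen : ℕ → ℝ) (x : Fin n → EuclideanSpace ℝ (Fin p)) : ℕ :=
  sInf {v : ℕ | v ∈ Set.Ioo 0 n ∧ ∀ w ∈ Set.Ioo 0 n, score pen x w ≤ score pen x v}

end MeanChange

end

/-! Write `b_v` for `stepCusum n η v`. After division by `σ` the CUSUM vector at `v` is `b_v θ/σ +
Z^v`, with `Z^v` standard Gaussian in `ℝ^p`. The proof shows that, off an event of probability at
most `16 n⁻⁷ ≤ 1/n`, every `v` satisfies `score v ≤ score η - (b_η² - b_v²) φ²/(2σ²) + 5000 h(k)`.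
The drop `b_η² - b_v²` is at least `min(|v - η|, Δ)/2` (`half_min_le_stepCusum_sq_sub`). A maximizer
scores at least as much as `η`, so `min(|v - η|, Δ) φ²/σ² ≤ 20000 h(k)`. The signal-to-noise
assumption prevents `Δ` from being that minimum, and the bound follows (`abs_sub_le_of_score_le`).

The score gap compares sums of squares, and the delicate term is the signal-noise cross term. It is
a Gaussian whose variance is exactly `(b_η² - b_v²) φ²/σ²` (`sum_sq_stepCusum_mul_sub`), so up to
`log n` it costs only half of the drop.

If `k < √(p log n)` (`score_le_of_sparse`), the penalty absorbs the off-support noise at `v` for all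
grid values at once. The score at `v` is then at most the sum of squares on the support. At `η`, a
grid value within a factor two of `k` recovers that sum up to `O(h(k))`, because `a² ≤ ν_a ≤ a² +
2`. If `k > √(p log n)` (`score_le_of_dense`), the score at `η` is read off at `t = p`, where there
is no thresholding. At `v` the threshold discards `belowThreshold`, which increases with `|x|`; a
nonzero mean therefore only helps its lower tail (`integral_shift_le`). The union over the grid
there produces the `log log (ep)` in `h`. All tails are Chernoff bounds resting on
`mgf_truncated_le`. -/

namespace MeanChange

/-! ### Gaussian integrals: the centring term, exponential moments, and shifts of the mean. -/

open Set Filter Topology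

/-- The centred thresholded square, whose sums over coordinates form the scores. -/
noncomputable def thresholded (a x : ℝ) : ℝ := if a ≤ |x| then x ^ 2 - centering a else 0

lemma measurable_thresholded (a : ℝ) : Measurable (thresholded a) := by
  unfold thresholded
  refine Measurable.ite ?_ (by fun_prop) measurable_const
  exact measurableSet_le measurable_const (by fun_prop)

lemma measurableSet_abs_ge (a : ℝ) : MeasurableSet {z : ℝ | a ≤ |z|} :=
  measurableSet_le measurable_const (by fun_prop)

lemma integrable_sq_gaussianReal : Integrable (fun z : ℝ => z ^ 2) (gaussianReal 0 1) :=
  (memLp_id_gaussianReal 2).integrable_sq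

lemma integral_sq_gaussianReal : ∫ z, z ^ 2 ∂(gaussianReal 0 1) = 1 := by
  have h := variance_fun_id_gaussianReal (μ := 0) (v := 1)
  rw [variance_eq_integral (by fun_prop)] at h
  simpa [integral_id_gaussianReal] using h

lemma gaussianReal_abs_ge_pos (a : ℝ) : 0 < (gaussianReal 0 1).real {z : ℝ | a ≤ |z|} := by
  have h : gaussianReal 0 1 {z : ℝ | a ≤ |z|} ≠ 0 := by
    intro h
    have h2 := gaussianReal_absolutelyContinuous' 0 (v := 1) (by norm_num) h
    have h3 : volume (Ici a) ≤ volume {z : ℝ | a ≤ |z|} :=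
      measure_mono fun z (hz : a ≤ z) => hz.trans (le_abs_self z)
    rw [h2, Real.volume_Ici] at h3
    simp at h3
  rw [measureReal_def]
  exact ENNReal.toReal_pos h (measure_ne_top _ _)

lemma centering_mul_prob (a : ℝ) :
    centering a * (gaussianReal 0 1).real {z : ℝ | a ≤ |z|}
      = ∫ z in {z : ℝ | a ≤ |z|}, z ^ 2 ∂(gaussianReal 0 1) := by
  have h := (gaussianReal_abs_ge_pos a).ne'
  rw [centering, ProbabilityTheory.cond, integral_smul_measure, ENNReal.toReal_inv,
    ← measureReal_def, smul_eq_mul]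
  field_simp

lemma thresholded_eq_indicator (a : ℝ) :
    thresholded a = {z : ℝ | a ≤ |z|}.indicator fun z => z ^ 2 - centering a := by
  ext z
  simp [thresholded, indicator]

lemma integral_thresholded (a : ℝ) : ∫ z, thresholded a z ∂(gaussianReal 0 1) = 0 := by
  rw [thresholded_eq_indicator, integral_indicator (measurableSet_abs_ge a), integral_sub
    integrable_sq_gaussianReal.integrableOn (integrable_const _), ← centering_mul_prob]
  simp [mul_comm]

lemma sq_le_centering {a : ℝ} (ha : 0 ≤ a) : a ^ 2 ≤ centering a := by
  have h := gaussianReal_abs_ge_pos a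
  refine le_of_mul_le_mul_right ?_ h
  rw [centering_mul_prob]
  have h2 : ∫ z in {z : ℝ | a ≤ |z|}, a ^ 2 ∂(gaussianReal 0 1)
      ≤ ∫ z in {z : ℝ | a ≤ |z|}, z ^ 2 ∂(gaussianReal 0 1) := by
    refine setIntegral_mono_on (integrable_const _) integrable_sq_gaussianReal.integrableOn
      (measurableSet_abs_ge a) fun z (hz : a ≤ |z|) => ?_
    rw [← sq_abs z]
    gcongr
  simpa [mul_comm] using h2

lemma centering_zero : centering 0 = 1 := by
  have h := centering_mul_prob 0
  simpa [integral_sq_gaussianReal] using h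

lemma thresholded_zero (x : ℝ) : thresholded 0 x = x ^ 2 - 1 := by
  simp [thresholded, centering_zero]

lemma integrable_sq_mul_exp : Integrable fun z : ℝ => z ^ 2 * Real.exp (-z ^ 2 / 2) := by
  have h := integrable_rpow_mul_exp_neg_mul_sq (b := 1 / 2) (by norm_num) (s := 2) (by norm_num)
  refine h.congr (ae_of_all _ fun z => ?_)
  simp only [Real.rpow_two]
  ring_nf

lemma integrable_exp_sq : Integrable fun z : ℝ => Real.exp (-z ^ 2 / 2) := by
  refine (integrable_exp_neg_mul_sq (b := 1 / 2) (by norm_num)).congr (ae_of_all _ fun z => ?_)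
  simp only
  ring_nf

lemma tendsto_mul_exp_neg_sq_half :
    Tendsto (fun z : ℝ => z * Real.exp (-z ^ 2 / 2)) atTop (𝓝 0) := by
  have h := Real.tendsto_pow_mul_exp_neg_atTop_nhds_zero 1
  refine squeeze_zero' (g := fun z : ℝ => z ^ 1 * Real.exp (-z)) ?_ ?_ h
  · filter_upwards [eventually_ge_atTop 0] with z hz
    positivity
  · filter_upwards [eventually_ge_atTop 2] with z hz
    rw [pow_one]
    gcongr
    nlinarith

/-- Since `a²/z² ≤ 1` on `z > a`, the integrand is at most `(z² - a² - 1 - a²/z²) e^{-z²/2}`. The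
latter has antiderivative `-(z - a²/z) e^{-z²/2}`, which vanishes both at `a` and at infinity. This
yields `ν_a ≤ a² + 2`. -/
lemma integral_Ioi_truncated_sq_nonpos {a : ℝ} (ha : 0 < a) :
    ∫ z in Ioi a, (z ^ 2 - a ^ 2 - 2) * Real.exp (-z ^ 2 / 2) ≤ 0 := by
  have hbd : IntegrableOn (fun z : ℝ => a ^ 2 / z ^ 2 * Real.exp (-z ^ 2 / 2)) (Ioi a) := by
    refine Integrable.mono' (integrable_exp_sq.integrableOn) ?_ ?_
    · exact (by fun_prop : Measurable _).aestronglyMeasurable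
    · refine (ae_restrict_mem measurableSet_Ioi).mono fun z hz => ?_
      have hz : a < z := hz
      have : 0 < z := ha.trans hz
      rw [Real.norm_of_nonneg (by positivity)]
      refine mul_le_of_le_one_left (by positivity) ?_
      rw [div_le_one (by positivity)]
      gcongr
  have hint : IntegrableOn
      (fun z : ℝ => (z ^ 2 - a ^ 2 - 1 - a ^ 2 / z ^ 2) * Real.exp (-z ^ 2 / 2)) (Ioi a) := by
    have := (integrable_sq_mul_exp.integrableOn (s := Ioi a)).sub
      ((integrable_exp_sq.integrableOn (s := Ioi a)).const_mul (a ^ 2 + 1))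
    refine (this.sub hbd).congr (ae_of_all _ fun z => ?_)
    simp only [Pi.sub_apply]
    ring
  have hint2 : IntegrableOn
      (fun z : ℝ => (z ^ 2 - a ^ 2 - 2) * Real.exp (-z ^ 2 / 2)) (Ioi a) := by
    have := (integrable_sq_mul_exp.integrableOn (s := Ioi a)).sub
      ((integrable_exp_sq.integrableOn (s := Ioi a)).const_mul (a ^ 2 + 2))
    refine this.congr (ae_of_all _ fun z => ?_)
    simp only [Pi.sub_apply]
    ring
  have hle : ∫ z in Ioi a, (z ^ 2 - a ^ 2 - 2) * Real.exp (-z ^ 2 / 2)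
      ≤ ∫ z in Ioi a, (z ^ 2 - a ^ 2 - 1 - a ^ 2 / z ^ 2) * Real.exp (-z ^ 2 / 2) := by
    refine setIntegral_mono_on hint2 hint measurableSet_Ioi fun z (hz : a < z) => ?_
    have hz0 : 0 < z := ha.trans hz
    have h1 : a ^ 2 / z ^ 2 ≤ 1 := by
      rw [div_le_one (by positivity)]
      gcongr
    refine mul_le_mul_of_nonneg_right ?_ (Real.exp_pos _).le
    linarith
  refine hle.trans (le_of_eq ?_)
  have h := integral_Ioi_of_hasDerivAt_of_tendsto' (a := a) (m := 0)
    (f := fun z : ℝ => -((z - a ^ 2 / z) * Real.exp (-z ^ 2 / 2)))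
    (f' := fun z : ℝ => (z ^ 2 - a ^ 2 - 1 - a ^ 2 / z ^ 2) * Real.exp (-z ^ 2 / 2)) ?_ hint ?_
  · rw [h]
    field_simp
    ring
  · intro z (hz : a ≤ z)
    have hz0 : z ≠ 0 := (ha.trans_le hz).ne'
    have h1 : HasDerivAt (fun z : ℝ => z - a ^ 2 / z) (1 - (0 * z - a ^ 2 * 1) / z ^ 2) z :=
      (hasDerivAt_id z).sub ((hasDerivAt_const z (a ^ 2)).div (hasDerivAt_id z) hz0)
    have h2 : HasDerivAt (fun z : ℝ => Real.exp (-z ^ 2 / 2))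
        (Real.exp (-z ^ 2 / 2) * (-(2 * z) / 2)) z := by
      have := (((hasDerivAt_pow 2 z).neg).div_const 2).exp
      simpa using this
    refine (h1.mul h2).neg.congr_deriv ?_
    field_simp
    ring
  · have h0 := tendsto_mul_exp_neg_sq_half
    have h1 : Tendsto (fun z : ℝ => (1 - a ^ 2 / z ^ 2) * (z * Real.exp (-z ^ 2 / 2))) atTop
        (𝓝 ((1 - 0) * 0)) := by
      refine (tendsto_const_nhds.sub ?_).mul h0
      exact tendsto_const_nhds.div_atTop (tendsto_pow_atTop (by norm_num))
    have h2 := h1.neg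
    simp only [mul_zero, neg_zero] at h2
    refine h2.congr' ?_
    filter_upwards [eventually_gt_atTop 0] with z hz
    field_simp

lemma integral_gaussianReal_eq (f : ℝ → ℝ) :
    ∫ z, f z ∂(gaussianReal 0 1) = (√(2 * Real.pi))⁻¹ * ∫ z, f z * Real.exp (-z ^ 2 / 2) := by
  rw [integral_gaussianReal_eq_integral_smul (by norm_num), ← integral_const_mul]
  congr 1 with z
  simp [gaussianPDFReal]
  ring

lemma centering_le {a : ℝ} (ha : 0 ≤ a) : centering a ≤ a ^ 2 + 2 := by
  rcases ha.eq_or_lt with rfl | ha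
  · rw [centering_zero]; norm_num
  have h := gaussianReal_abs_ge_pos a
  refine le_of_mul_le_mul_right ?_ h
  rw [centering_mul_prob]
  have hA := measurableSet_abs_ge a
  suffices hs : ∫ z in {z : ℝ | a ≤ |z|}, (z ^ 2 - (a ^ 2 + 2)) ∂(gaussianReal 0 1) ≤ 0 by
    rw [integral_sub integrable_sq_gaussianReal.integrableOn (integrable_const _)] at hs
    simp only [setIntegral_const, smul_eq_mul] at hs
    linarith
  rw [← integral_indicator hA, integral_gaussianReal_eq]
  refine mul_nonpos_of_nonneg_of_nonpos (by positivity) ?_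
  have heq : (fun z : ℝ => {z : ℝ | a ≤ |z|}.indicator (fun z => z ^ 2 - (a ^ 2 + 2)) z
      * Real.exp (-z ^ 2 / 2)) = fun z => (Ici a).indicator
        (fun r => (r ^ 2 - a ^ 2 - 2) * Real.exp (-r ^ 2 / 2)) |z| := by
    ext z
    by_cases hz : a ≤ |z|
    · simp only [indicator, mem_ofPred_eq, hz, if_true, mem_Ici, sq_abs]
      ring
    · simp [indicator, hz]
  rw [heq, integral_comp_abs (f := (Ici a).indicator
        (fun r => (r ^ 2 - a ^ 2 - 2) * Real.exp (-r ^ 2 / 2))),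
    setIntegral_indicator measurableSet_Ici,
    inter_eq_self_of_subset_right (show Ici a ⊆ Ioi 0 from fun z hz => ha.trans_le hz),
    integral_Ici_eq_integral_Ioi]
  have := integral_Ioi_truncated_sq_nonpos ha
  linarith

lemma abs_thresholded_le {a : ℝ} (ha : 0 ≤ a) (z : ℝ) :
    |thresholded a z| ≤ {z : ℝ | a ≤ |z|}.indicator (fun z => z ^ 2 + 2) z := by
  rw [thresholded_eq_indicator]
  by_cases hz : z ∈ {z : ℝ | a ≤ |z|}
  · rw [indicator_of_mem hz, indicator_of_mem hz]
    have h1 := sq_le_centering ha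
    have h2 := centering_le ha
    have h3 : a ^ 2 ≤ z ^ 2 := by
      rw [← sq_abs z]
      exact pow_le_pow_left₀ ha hz 2
    rw [abs_le]
    constructor <;> nlinarith [sq_nonneg a]
  · rw [indicator_of_notMem hz, indicator_of_notMem hz, abs_zero]

lemma integrable_exp_sq_gaussianReal :
    Integrable (fun z : ℝ => Real.exp (3 / 8 * z ^ 2)) (gaussianReal 0 1) := by
  rw [gaussianReal_of_var_ne_zero _ (by norm_num), integrable_withDensity_iff
    (measurable_gaussianPDF _ _) (ae_of_all _ fun _ => gaussianPDF_lt_top)]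
  have := (integrable_exp_neg_mul_sq (b := 1 / 8) (by norm_num)).const_mul (√(2 * Real.pi))⁻¹
  refine this.congr (ae_of_all _ fun z => ?_)
  simp only [toReal_gaussianPDF, gaussianPDFReal]
  rw [mul_comm (Real.exp _) (_ * _), mul_assoc, ← Real.exp_add]
  congr 2
  · simp only [NNReal.coe_one, mul_one]
  · simp only [NNReal.coe_one, sub_zero]
    ring

lemma integral_exp_sq_gaussianReal :
    ∫ z, Real.exp (3 / 8 * z ^ 2) ∂(gaussianReal 0 1) = 2 := by
  rw [integral_gaussianReal_eq]
  have : ∀ z : ℝ, Real.exp (3 / 8 * z ^ 2) * Real.exp (-z ^ 2 / 2)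
      = Real.exp (-(1 / 8) * z ^ 2) := by
    intro z
    rw [← Real.exp_add]
    ring_nf
  simp_rw [this]
  rw [integral_gaussian, show Real.pi / (1 / 8) = 2 ^ 2 * (2 * Real.pi) by ring,
    Real.sqrt_mul (by positivity) (2 * Real.pi), Real.sqrt_sq (by norm_num)]
  have : √(2 * Real.pi) ≠ 0 := by positivity
  field_simp

lemma exp_le_one_add_add_sq (x : ℝ) : Real.exp x ≤ 1 + x + x ^ 2 * Real.exp |x| := by
  have h := Complex.norm_exp_sub_sum_le_norm_mul_exp (x : ℂ) 2
  simp only [Finset.sum_range_succ, Finset.sum_range_zero] at h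
  have h2 : Complex.exp x - (0 + (x : ℂ) ^ 0 / (Nat.factorial 0 : ℕ) + (x : ℂ) ^ 1 / (Nat.factorial 1 : ℕ))
      = ((Real.exp x - (1 + x) : ℝ) : ℂ) := by
    push_cast
    simp
  rw [h2, Complex.norm_real, Complex.norm_real, Real.norm_eq_abs, Real.norm_eq_abs, sq_abs] at h
  linarith [le_abs_self (Real.exp x - (1 + x))]

/-- A centred function of a standard Gaussian variable, of at most quadratic growth and supported
on `{|z| ≥ a}`, has a moment generating function of Bernstein type near zero. -/
lemma mgf_truncated_le {F : ℝ → ℝ} (hF : Measurable F) {a : ℝ} (ha : 0 ≤ a)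
    (hbound : ∀ z, |F z| ≤ {z : ℝ | a ≤ |z|}.indicator (fun z => 2 * z ^ 2 + 3) z)
    (hzero : ∫ z, F z ∂(gaussianReal 0 1) = 0) {s : ℝ} (hs : |s| ≤ 1 / 32) :
    Integrable (fun z => Real.exp (s * F z)) (gaussianReal 0 1) ∧
    ∫ z, Real.exp (s * F z) ∂(gaussianReal 0 1)
      ≤ Real.exp (8192 * s ^ 2 * Real.exp (-(a ^ 2) / 4)) := by
  -- The polynomial factor is traded for exponentials, which leaves `e^{z²/8}`. On the support `z² ≥
  -- a²`, so `e^{z²/8} ≤ e^{-a²/4} e^{3z²/8}`; this is the source of the gain `e^{-a²/4}`. The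
  -- exponent `3/8` makes the remaining Gaussian integral equal to `2`.
  have hpt : ∀ z, (s * F z) ^ 2 * Real.exp |s * F z|
      ≤ 4096 * s ^ 2 * Real.exp (-(a ^ 2) / 4) * Real.exp (3 / 8 * z ^ 2) := by
    intro z
    by_cases hz : z ∈ {z : ℝ | a ≤ |z|}
    · have hb := hbound z
      rw [indicator_of_mem hz] at hb
      have hz2 : a ^ 2 ≤ z ^ 2 := by
        rw [← sq_abs z]
        exact pow_le_pow_left₀ ha hz 2
      have h1 : (F z) ^ 2 ≤ (2 * z ^ 2 + 3) ^ 2 := by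
        rw [← sq_abs]
        gcongr
      have h2 : |s * F z| ≤ 1 / 32 * (2 * z ^ 2 + 3) := by
        rw [abs_mul]
        gcongr
      have h3 : (2 * z ^ 2 + 3) ^ 2 ≤ 2048 * Real.exp (1 / 32 * (2 * z ^ 2 + 3)) := by
        have := Real.quadratic_le_exp_of_nonneg
          (show 0 ≤ 1 / 32 * (2 * z ^ 2 + 3) by positivity)
        nlinarith [sq_nonneg z]
      have h4 : Real.exp (3 / 16) ≤ 2 := by
        have : Real.exp (3 / 16) ≤ Real.exp (Real.log 2) := by
          gcongr
          linarith [Real.log_two_gt_d9]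
        rwa [Real.exp_log (by norm_num)] at this
      calc (s * F z) ^ 2 * Real.exp |s * F z|
          ≤ (s ^ 2 * (2048 * Real.exp (1 / 32 * (2 * z ^ 2 + 3))))
            * Real.exp (1 / 32 * (2 * z ^ 2 + 3)) := by
            rw [mul_pow]
            gcongr
            exact h1.trans h3
        _ = 2048 * s ^ 2 * (Real.exp (3 / 16) * Real.exp (1 / 8 * z ^ 2)) := by
            rw [mul_assoc, mul_assoc, ← Real.exp_add, ← Real.exp_add]
            ring_nf
        _ ≤ 2048 * s ^ 2 * (2 * Real.exp (-(a ^ 2) / 4 + 3 / 8 * z ^ 2)) := by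
            gcongr
            linarith
        _ = _ := by rw [Real.exp_add]; ring
    · have hb := hbound z
      rw [indicator_of_notMem hz] at hb
      have : F z = 0 := abs_eq_zero.mp (le_antisymm hb (abs_nonneg _))
      simp only [this, mul_zero]
      norm_num
      positivity
  have hFint : Integrable F (gaussianReal 0 1) := by
    refine Integrable.mono' (g := fun z => 2 * z ^ 2 + 3)
      ((integrable_sq_gaussianReal.const_mul 2).add (integrable_const _))
      hF.aestronglyMeasurable (ae_of_all _ fun z => (hbound z).trans ?_)
    exact indicator_le_self' (fun _ _ => by positivity) z
  have hint : Integrable (fun z => 1 + s * F z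
      + 4096 * s ^ 2 * Real.exp (-(a ^ 2) / 4) * Real.exp (3 / 8 * z ^ 2)) (gaussianReal 0 1) :=
    ((integrable_const _).add (hFint.const_mul s)).add (integrable_exp_sq_gaussianReal.const_mul _)
  have hle : ∀ z, Real.exp (s * F z) ≤ 1 + s * F z
      + 4096 * s ^ 2 * Real.exp (-(a ^ 2) / 4) * Real.exp (3 / 8 * z ^ 2) := fun z =>
    (exp_le_one_add_add_sq _).trans (by linarith [hpt z])
  have hI : Integrable (fun z => Real.exp (s * F z)) (gaussianReal 0 1) := by
    refine hint.mono' (by fun_prop) (ae_of_all _ fun z => ?_)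
    rw [Real.norm_of_nonneg (Real.exp_pos _).le]
    exact hle z
  refine ⟨hI, ?_⟩
  calc ∫ z, Real.exp (s * F z) ∂(gaussianReal 0 1)
      ≤ ∫ z, (1 + s * F z + 4096 * s ^ 2 * Real.exp (-(a ^ 2) / 4) * Real.exp (3 / 8 * z ^ 2))
          ∂(gaussianReal 0 1) := integral_mono hI hint hle
    _ = 8192 * s ^ 2 * Real.exp (-(a ^ 2) / 4) + 1 := by
        rw [integral_add (f := fun z => 1 + s * F z) ((integrable_const _).add (hFint.const_mul s))
          (integrable_exp_sq_gaussianReal.const_mul _), integral_add (integrable_const _)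
          (hFint.const_mul s), integral_const_mul, integral_const_mul, hzero,
          integral_exp_sq_gaussianReal]
        simp
        ring
    _ ≤ _ := Real.add_one_le_exp _

/-- Shifting a centred Gaussian variable decreases the integral of an even function that is
nonincreasing in `|z|`. -/
lemma integral_shift_le {φ : ℝ → ℝ} (hφ : Measurable φ) {B : ℝ}
    (hB : ∀ z, |φ z| ≤ B) (hmono : ∀ x y, |x| ≤ |y| → φ y ≤ φ x) (m : ℝ) :
    ∫ z, φ (m + z) ∂(gaussianReal 0 1) ≤ ∫ z, φ z ∂(gaussianReal 0 1) := by
  rcases eq_or_ne m 0 with rfl | hm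
  · simp
  have heven : ∀ z, φ (-z) = φ z := fun z =>
    le_antisymm (hmono _ _ (by simp)) (hmono _ _ (by simp))
  set γ := gaussianReal 0 1
  have hexp : ∀ c : ℝ, Integrable (fun z => Real.exp (c * z)) γ := fun c =>
    integrable_exp_mul_gaussianReal c
  have hexpI : ∀ c : ℝ, ∫ z, Real.exp (c * z) ∂γ = Real.exp (c ^ 2 / 2) := fun c => by
    have := congrFun (mgf_fun_id_gaussianReal (μ := 0) (v := 1)) c
    simpa [mgf] using this
  have hφe : ∀ c : ℝ, Integrable (fun z => φ z * Real.exp (c * z)) γ := fun c =>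
    (hexp c).bdd_mul hφ.aestronglyMeasurable (ae_of_all _ fun z => hB z)
  have hshift : ∫ z, φ (m + z) ∂γ = Real.exp (-m ^ 2 / 2) * ∫ z, φ z * Real.exp (m * z) ∂γ := by
    rw [integral_gaussianReal_eq, integral_gaussianReal_eq, mul_left_comm]
    congr 1
    rw [← integral_const_mul]
    have := integral_add_left_eq_self (μ := volume) (fun z => φ z * Real.exp (-(z - m) ^ 2 / 2)) m
    simp only [add_sub_cancel_left] at this
    rw [this]
    congr 1 with z
    rw [mul_left_comm, mul_assoc, ← Real.exp_add, ← Real.exp_add]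
    ring_nf
  have hsymm : ∫ z, φ z * Real.exp (-m * z) ∂γ = ∫ z, φ z * Real.exp (m * z) ∂γ := by
    have h1 : γ.map (fun z => -z) = γ := by simp [γ, gaussianReal_map_neg]
    conv_rhs => rw [← h1]
    rw [integral_map (by fun_prop) (by fun_prop)]
    simp [heven]
  -- The density of the shifted law relative to the centred one, symmetrized in `z`. It has mean one
  -- and increases with `|z|`.
  set ψ : ℝ → ℝ := fun z => Real.exp (-m ^ 2 / 2) * Real.cosh (m * z) with hψ
  have hψint : Integrable ψ γ := by
    simp_rw [hψ, Real.cosh_eq, ← neg_mul]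
    exact (((hexp m).add (hexp (-m))).div_const 2).const_mul _
  have hφψ : Integrable (fun z => φ z * ψ z) γ :=
    hψint.bdd_mul hφ.aestronglyMeasurable (ae_of_all _ fun z => hB z)
  have hψ1 : ∫ z, ψ z ∂γ = 1 := by
    simp_rw [hψ, Real.cosh_eq, ← neg_mul]
    rw [integral_const_mul, integral_div, integral_add (hexp m) (hexp (-m)), hexpI, hexpI, neg_sq,
      ← two_mul, mul_div_cancel_left₀ _ (by norm_num), ← Real.exp_add]
    ring_nf
    simp
  have hφψI : ∫ z, φ z * ψ z ∂γ = ∫ z, φ (m + z) ∂γ := by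
    have : ∀ z, φ z * ψ z = Real.exp (-m ^ 2 / 2) / 2 *
        (φ z * Real.exp (m * z) + φ z * Real.exp (-m * z)) := by
      intro z
      simp only [hψ, Real.cosh_eq, neg_mul]
      ring
    simp_rw [this]
    rw [integral_const_mul, integral_add (hφe m) (hφe (-m)), hsymm, hshift]
    ring
  have hφint : Integrable φ γ := by
    simpa using hφe 0
  obtain ⟨y, hy⟩ : ∃ y, ψ y = 1 := by
    refine ⟨Real.arcosh (Real.exp (m ^ 2 / 2)) / m, ?_⟩
    simp only [hψ]
    rw [mul_div_cancel₀ _ hm, Real.cosh_arcosh (Real.one_le_exp (by positivity)), ← Real.exp_add]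
    ring_nf
    simp
  have hψmono : ∀ x z : ℝ, |x| ≤ |z| → ψ x ≤ ψ z := by
    intro x z hxz
    simp only [hψ]
    gcongr
    rw [Real.cosh_le_cosh, abs_mul, abs_mul]
    gcongr
  -- Chebyshev's association inequality: `φ` and `ψ` are oppositely monotone in `|z|`, so both
  -- factors change sign at the level `|y|` where `ψ = 1`.
  have hneg : ∀ z, (φ z - φ y) * (ψ z - 1) ≤ 0 := by
    intro z
    rw [← hy]
    rcases le_total |y| |z| with h | h
    · exact mul_nonpos_of_nonpos_of_nonneg (by linarith [hmono _ _ h]) (by linarith [hψmono _ _ h])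
    · exact mul_nonpos_of_nonneg_of_nonpos (by linarith [hmono _ _ h]) (by linarith [hψmono _ _ h])
  have hfin : ∫ z, (φ z * ψ z - φ z - φ y * ψ z + φ y) ∂γ ≤ 0 :=
    integral_nonpos fun z => by
      have := hneg z
      simp only [Pi.zero_apply]
      linarith
  rw [integral_add (f := fun z => φ z * ψ z - φ z - φ y * ψ z)
      ((hφψ.sub hφint).sub (hψint.const_mul _)) (integrable_const _),
    integral_sub (f := fun z => φ z * ψ z - φ z) (hφψ.sub hφint) (hψint.const_mul _), integral_sub hφψ hφint,
    integral_const_mul, hψ1, hφψI] at hfin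
  simp [γ] at hfin
  linarith

end MeanChange

/-! ### No positive integer lies on the boundary between the two regimes. -/

namespace MeanChange

open Filter Topology

/-- The Lindemann–Weierstrass approximation at a large prime `q` makes `a N - q g(m)` an integer of
absolute value below one, hence zero. Then `q` divides `a N`, although `q ∤ a` and `q > N`. -/
lemma exp_natCast_ne_natCast {m : ℕ} (hm : m ≠ 0) (N : ℕ) : Real.exp m ≠ N := by
  intro hN
  have hNpos : 0 < N := by
    have : (0 : ℝ) < N := hN ▸ Real.exp_pos _
    exact_mod_cast this
  obtain ⟨c, hc⟩ := LindemannWeierstrass.exp_polynomial_approx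
    (Polynomial.X - Polynomial.C (m : ℤ)) (by simpa using hm)
  have hlim : Tendsto (fun q : ℕ => c * (c ^ q / (q.factorial : ℝ))) atTop (𝓝 (c * 0)) :=
    (FloorSemiring.tendsto_pow_div_factorial_atTop c).const_mul c
  rw [mul_zero] at hlim
  obtain ⟨Q, hQ⟩ := eventually_atTop.mp (hlim.eventually (gt_mem_nhds zero_lt_one))
  obtain ⟨q, hq, hprime⟩ := Nat.exists_infinite_primes (Q + m + N + 2)
  obtain ⟨a, ha, g, -, hg⟩ := hc q (by simp; omega) hprime
  have hroot : (m : ℂ) ∈ (Polynomial.X - Polynomial.C (m : ℤ)).aroots ℂ := by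
    rw [Polynomial.mem_aroots]
    refine ⟨Polynomial.X_sub_C_ne_zero _, by simp⟩
  have h := hg hroot
  have hsmall : c ^ q / ((q - 1).factorial : ℝ) < 1 := by
    have := hQ (q - 1) (by omega)
    rwa [← mul_div_assoc, ← pow_succ', Nat.sub_add_cancel hprime.one_le] at this
  have hexp : Complex.exp (m : ℂ) = (N : ℂ) := by
    have := congrArg (fun x : ℝ => (x : ℂ)) hN
    simpa using this
  have heval : Polynomial.aeval (m : ℂ) g = ((g.eval (m : ℤ) : ℤ) : ℂ) := by
    have := Polynomial.aeval_algebraMap_apply ℂ (m : ℤ) g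
    simpa using this
  rw [hexp, heval] at h
  have hint : a • (N : ℂ) - q • ((g.eval (m : ℤ) : ℤ) : ℂ)
      = ((a * N - q * g.eval (m : ℤ) : ℤ) : ℂ) := by
    push_cast
    simp
  rw [hint, Complex.norm_intCast] at h
  have h1 : |(a * N - q * g.eval (m : ℤ) : ℤ)| < 1 := by
    have := h.trans_lt hsmall
    exact_mod_cast this
  have h2 : a * N = q * g.eval (m : ℤ) := by
    have := Int.abs_lt_one_iff.mp h1
    linarith
  have h3 : (q : ℤ) ∣ a * N := ⟨_, h2⟩
  rcases (Nat.prime_iff_prime_int.mp hprime).dvd_or_dvd h3 with h4 | h4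
  · exact ha h4
  · have := Nat.le_of_dvd hNpos (Int.natCast_dvd_natCast.mp h4)
    omega

/-- Equality would give `e^{t²} = n^p`. At equality `threshold` would take its sparse branch while
`penaltyRate` and `rate` take their dense one; excluding it puts every `t` strictly on one side. -/
lemma natCast_ne_sqrt_mul_log {n : ℕ} (hn : 0 < n) (p : ℕ) {t : ℕ} (ht : t ≠ 0) :
    (t : ℝ) ≠ √(p * Real.log n) := by
  intro h
  have h0 : 0 ≤ (p : ℝ) * Real.log n := mul_nonneg (by positivity) (Real.log_natCast_nonneg n)
  have h2 : ((t ^ 2 : ℕ) : ℝ) = p * Real.log n := by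
    push_cast
    rw [h, Real.sq_sqrt h0]
  refine exp_natCast_ne_natCast (m := t ^ 2) (by positivity) (n ^ p) ?_
  rw [h2, ← Real.log_pow, Real.exp_log (by positivity)]
  push_cast
  rfl

end MeanChange

/-! ### Laws of linear combinations of the noise, and a Chernoff bound for product measures. -/

namespace MeanChange

open scoped RealInnerProductSpace

section Law

variable {n p : ℕ} {Ω : Type*} [MeasurableSpace Ω] {P : Measure Ω}
  {W : Fin n → Ω → EuclideanSpace ℝ (Fin p)} {σ : ℝ}

lemma charFun_multivariateGaussian_scalar (c : ℝ) (x : EuclideanSpace ℝ (Fin p)) :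
    charFun (multivariateGaussian 0 (c ^ 2 • (1 : Matrix (Fin p) (Fin p) ℝ))) x
      = Complex.exp ((-(c ^ 2 * ‖x‖ ^ 2 / 2) : ℝ) : ℂ) := by
  rw [charFun_multivariateGaussian (Matrix.PosSemidef.one.smul (sq_nonneg c))]
  congr 1
  rw [EuclideanSpace.real_norm_sq_eq]
  simp [Matrix.smul_mulVec, dotProduct, Finset.mul_sum, sq]
  exact Finset.sum_congr rfl fun i _ => by ring

lemma charFun_linearCombination (hσ : 0 < σ) (hind : iIndepFun W P)
    (hlaw : ∀ v, HasLaw (W v)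
      (multivariateGaussian 0 (σ ^ 2 • (1 : Matrix (Fin p) (Fin p) ℝ))) P)
    (w : Fin n → ℝ) (x : EuclideanSpace ℝ (Fin p)) :
    charFun (P.map fun ω => ∑ t, w t • (1 / σ) • W t ω) x
      = Complex.exp ((-((∑ t, w t ^ 2) * ‖x‖ ^ 2 / 2) : ℝ) : ℂ) := by
  have hmeas : ∀ t, AEMeasurable (W t) P := fun t => (hlaw t).aemeasurable
  have hind2 : iIndepFun (fun t ω => (w t * (1 / σ)) • W t ω) P :=
    hind.comp (fun t y => (w t * (1 / σ)) • y) fun t => by fun_prop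
  simp_rw [smul_smul]
  rw [hind2.charFun_map_fun_sum_eq_prod
    (fun t => by have := hmeas t; fun_prop), Finset.prod_apply]
  have : ∀ t, charFun (P.map fun ω => (w t * (1 / σ)) • W t ω) x
      = Complex.exp ((-(w t ^ 2 * ‖x‖ ^ 2 / 2) : ℝ) : ℂ) := by
    intro t
    rw [charFun_map_smul_comp (hmeas t), (hlaw t).map_eq, charFun_multivariateGaussian_scalar,
      norm_smul, mul_pow, Real.norm_eq_abs, sq_abs]
    congr 2
    field_simp
  simp_rw [this]
  rw [← Complex.exp_sum, ← Complex.ofReal_sum, Finset.sum_neg_distrib, Finset.sum_mul,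
    Finset.sum_div]

lemma aemeasurable_linearCombination
    (hlaw : ∀ v, HasLaw (W v)
      (multivariateGaussian 0 (σ ^ 2 • (1 : Matrix (Fin p) (Fin p) ℝ))) P) (w : Fin n → ℝ) :
    AEMeasurable (fun ω => ∑ t, w t • (1 / σ) • W t ω) P :=
  Finset.aemeasurable_fun_sum _ fun t _ => by have := (hlaw t).aemeasurable; fun_prop

variable [IsProbabilityMeasure P]

lemma hasLaw_linearCombination (hσ : 0 < σ) (hind : iIndepFun W P)
    (hlaw : ∀ v, HasLaw (W v)
      (multivariateGaussian 0 (σ ^ 2 • (1 : Matrix (Fin p) (Fin p) ℝ))) P)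
    {w : Fin n → ℝ} (hw : ∑ t, w t ^ 2 = 1) :
    HasLaw (fun ω i => ∑ t, w t * ((1 / σ) • W t ω) i)
      (Measure.pi fun _ : Fin p => gaussianReal 0 1) P := by
  have hm := aemeasurable_linearCombination hlaw w
  have hstd : P.map (fun ω => ∑ t, w t • (1 / σ) • W t ω)
      = stdGaussian (EuclideanSpace ℝ (Fin p)) := by
    have : IsProbabilityMeasure (P.map (fun ω => ∑ t, w t • (1 / σ) • W t ω)) :=
      Measure.isProbabilityMeasure_map hm
    refine Measure.ext_of_charFun ?_
    ext x
    rw [charFun_linearCombination hσ hind hlaw, hw, charFun_stdGaussian]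
    push_cast
    ring_nf
  have heq : (fun ω i => ∑ t, w t * ((1 / σ) • W t ω) i)
      = WithLp.ofLp ∘ fun ω => ∑ t, w t • (1 / σ) • W t ω := by
    ext ω i
    simp
  refine ⟨?_, ?_⟩
  · rw [heq]
    exact (by fun_prop : Measurable (WithLp.ofLp : EuclideanSpace ℝ (Fin p) → _)).comp_aemeasurable
      hm
  · rw [heq, ← AEMeasurable.map_map_of_aemeasurable (by fun_prop) hm, hstd,
      ← map_pi_eq_stdGaussian, Measure.map_map (by fun_prop) (by fun_prop)]
    exact Measure.map_id

lemma hasLaw_inner_linearCombination (hσ : 0 < σ) (hind : iIndepFun W P)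
    (hlaw : ∀ v, HasLaw (W v)
      (multivariateGaussian 0 (σ ^ 2 • (1 : Matrix (Fin p) (Fin p) ℝ))) P)
    (w : Fin n → ℝ) (θ : EuclideanSpace ℝ (Fin p)) :
    HasLaw (fun ω => ⟪∑ t, w t • (1 / σ) • W t ω, θ⟫)
      (gaussianReal 0 ((∑ t, w t ^ 2) * ‖θ‖ ^ 2).toNNReal) P := by
  have hm := aemeasurable_linearCombination hlaw w
  have hm2 : AEMeasurable (fun ω => ⟪∑ t, w t • (1 / σ) • W t ω, θ⟫) P :=
    hm.inner_const
  have hnn : 0 ≤ (∑ t, w t ^ 2) * ‖θ‖ ^ 2 := by positivity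
  refine ⟨hm2, ?_⟩
  have : IsProbabilityMeasure (P.map (fun ω => ⟪∑ t, w t • (1 / σ) • W t ω, θ⟫)) :=
    Measure.isProbabilityMeasure_map hm2
  refine Measure.ext_of_charFun ?_
  ext τ
  have h1 : charFun (P.map (fun ω => ⟪∑ t, w t • (1 / σ) • W t ω, θ⟫)) τ
      = charFun (P.map (fun ω => ∑ t, w t • (1 / σ) • W t ω)) (τ • θ) := by
    rw [charFun_apply, charFun_apply, integral_map hm2 (by fun_prop),
      integral_map hm (by fun_prop)]
    congr 1 with ω
    simp [inner_smul_right, mul_comm]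
  rw [h1, charFun_linearCombination hσ hind hlaw, charFun_gaussianReal, norm_smul, mul_pow,
    Real.norm_eq_abs, sq_abs, Real.coe_toNNReal _ hnn]
  push_cast
  ring_nf

/-- A Gaussian linear functional exceeds a quarter of its variance by `y` with probability at most
`exp (-y / 2)`. -/
lemma prob_inner_linearCombination_le (hσ : 0 < σ) (hind : iIndepFun W P)
    (hlaw : ∀ v, HasLaw (W v)
      (multivariateGaussian 0 (σ ^ 2 • (1 : Matrix (Fin p) (Fin p) ℝ))) P)
    (w : Fin n → ℝ) (θ : EuclideanSpace ℝ (Fin p)) (y : ℝ) :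
    P.real {ω | (∑ t, w t ^ 2) * ‖θ‖ ^ 2 / 4 + y ≤ ⟪∑ t, w t • (1 / σ) • W t ω, θ⟫}
      ≤ Real.exp (-y / 2) := by
  have h := hasLaw_inner_linearCombination hσ hind hlaw w θ
  have hnn : 0 ≤ (∑ t, w t ^ 2) * ‖θ‖ ^ 2 := by positivity
  set X := fun ω => ⟪∑ t, w t • (1 / σ) • W t ω, θ⟫
  have hint : Integrable (fun ω => Real.exp (1 / 2 * X ω)) P := by
    have := integrable_exp_mul_gaussianReal (μ := 0)
      (v := ((∑ t, w t ^ 2) * ‖θ‖ ^ 2).toNNReal) (1 / 2)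
    rw [← h.map_eq] at this
    exact this.comp_aemeasurable h.aemeasurable
  -- With variance `V`, the tilt `1/2` gives `-(V/4 + y)/2 + V/8 = -y/2`, so the variance cancels
  -- exactly.
  refine (measure_ge_le_exp_mul_mgf _ (by norm_num : (0 : ℝ) ≤ 1 / 2) hint).trans ?_
  rw [mgf_gaussianReal h.map_eq, ← Real.exp_add, Real.coe_toNNReal _ hnn]
  refine Real.exp_le_exp.mpr (le_of_eq ?_)
  ring

end Law

lemma prob_pi_sum_ge_le {ι : Type*} [Fintype ι] [DecidableEq ι] (A : Finset ι)
    (G : ι → ℝ → ℝ) (b : ι → ℝ)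
    (hint : ∀ i ∈ A, Integrable (fun z => Real.exp (G i z)) (gaussianReal 0 1))
    (hle : ∀ i ∈ A, ∫ z, Real.exp (G i z) ∂(gaussianReal 0 1) ≤ Real.exp (b i)) (x : ℝ) :
    (Measure.pi fun _ : ι => gaussianReal 0 1).real {z | x ≤ ∑ i ∈ A, G i (z i)}
      ≤ Real.exp (-x + ∑ i ∈ A, b i) := by
  set f : ι → ℝ → ℝ := fun i z => if i ∈ A then Real.exp (G i z) else 1 with hf
  have hprod : ∀ z : ι → ℝ, ∏ i, f i (z i) = Real.exp (∑ i ∈ A, G i (z i)) := by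
    intro z
    simp [hf, Finset.prod_ite_mem, Real.exp_sum]
  have hfint : ∀ i, Integrable (f i) (gaussianReal 0 1) := by
    intro i
    by_cases hi : i ∈ A
    · simpa [hf, hi] using hint i hi
    · simp [hf, hi]
  have hI := Integrable.fintype_prod (μ := fun _ : ι => gaussianReal 0 1) hfint
  have hval := integral_fintype_prod_eq_prod (𝕜 := ℝ) f (μ := fun _ => gaussianReal 0 1)
  simp_rw [hprod] at hI hval
  have hbound : ∏ i, ∫ z, f i z ∂(gaussianReal 0 1) ≤ Real.exp (∑ i ∈ A, b i) := by
    have : ∏ i, ∫ z, f i z ∂(gaussianReal 0 1)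
        = ∏ i ∈ A, ∫ z, Real.exp (G i z) ∂(gaussianReal 0 1) := by
      rw [← Finset.prod_subset (Finset.subset_univ A)]
      · refine Finset.prod_congr rfl fun i hi => ?_
        simp [hf, hi]
      · intro i _ hi
        simp [hf, hi]
    rw [this, Real.exp_sum]
    refine Finset.prod_le_prod (fun i _ => integral_nonneg fun z => (Real.exp_pos _).le) hle
  have hmarkov := measure_ge_le_exp_mul_mgf (μ := Measure.pi fun _ : ι => gaussianReal 0 1)
    (X := fun z => ∑ i ∈ A, G i (z i)) x zero_le_one (by simpa using hI)
  refine hmarkov.trans ?_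
  simp only [mgf, one_mul]
  rw [hval, Real.exp_add, neg_one_mul]
  gcongr

end MeanChange

/-! ### Algebra of the CUSUM contrasts and the mean of the data. -/

namespace MeanChange

section Cusum

variable {n : ℕ}

/-- The coefficients of the CUSUM transformation at `v`. -/
noncomputable def cusumCoeff (v : ℕ) (t : Fin n) : ℝ :=
  if t.val < v then √(((n : ℝ) - v) / (n * v)) else -√((v : ℝ) / (n * ((n : ℝ) - v)))

lemma cusum_eq_sum (v : ℕ) (y : Fin n → ℝ) : cusum v y = ∑ t, cusumCoeff v t * y t := by
  simp only [cusum, cusumCoeff, ite_mul, Finset.sum_ite, Finset.mul_sum, not_lt, neg_mul,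
    Finset.sum_neg_distrib, sub_eq_add_neg]

lemma sum_ite_lt_eq {v : ℕ} (hv : v ≤ n) (α β : ℝ) :
    ∑ t : Fin n, (if t.val < v then α else β) = v * α + (n - v) * β := by
  rw [Fin.sum_univ_eq_sum_range (fun t => if t < v then α else β),
    ← Finset.sum_range_add_sum_Ico _ hv,
    Finset.sum_congr rfl (g := fun _ => α) fun t ht => if_pos (Finset.mem_range.mp ht),
    Finset.sum_congr rfl (g := fun _ => β) fun t ht => if_neg (by simp at ht; omega)]
  simp [Nat.cast_sub hv]

lemma sum_cusumCoeff_sq {v : ℕ} (hv : v ∈ Set.Ioo 0 n) :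
    ∑ t : Fin n, cusumCoeff v t ^ 2 = 1 := by
  obtain ⟨h0, h1⟩ := hv
  have h0' : (0 : ℝ) < v := by exact_mod_cast h0
  have h1' : (0 : ℝ) < n - v := by rw [sub_pos]; exact_mod_cast h1
  have h2' : (0 : ℝ) < n := by linarith
  simp only [cusumCoeff, ite_pow, neg_sq]
  rw [sum_ite_lt_eq h1.le, Real.sq_sqrt (by positivity), Real.sq_sqrt (by positivity)]
  field_simp
  ring

/-- This exhibits the CUSUM as one scalar times the difference of the two sample means, so that it
annihilates constants. -/
lemma sqrt_mul_cusum {v : ℕ} (hv : v ∈ Set.Ioo 0 n) :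
    √(((n : ℝ) - v) / (n * v)) = √((n - v) * v / n) / v ∧
    √((v : ℝ) / (n * ((n : ℝ) - v))) = √((n - v) * v / n) / (n - v) := by
  obtain ⟨h0, h1⟩ := hv
  have h0' : (0 : ℝ) < v := by exact_mod_cast h0
  have h1' : (0 : ℝ) < n - v := by rw [sub_pos]; exact_mod_cast h1
  have h2' : (0 : ℝ) < n := by linarith
  constructor
  · rw [eq_div_iff h0'.ne']
    nth_rewrite 3 [← Real.sqrt_sq h0'.le]
    rw [← Real.sqrt_mul (by positivity)]
    congr 1
    field_simp
  · rw [eq_div_iff h1'.ne']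
    nth_rewrite 2 [← Real.sqrt_sq h1'.le]
    rw [← Real.sqrt_mul (by positivity)]
    congr 1
    field_simp

lemma sum_cusumCoeff {v : ℕ} (hv : v ∈ Set.Ioo 0 n) : ∑ t : Fin n, cusumCoeff v t = 0 := by
  have h0' : (0 : ℝ) < v := by exact_mod_cast hv.1
  have h1' : (0 : ℝ) < n - v := by rw [sub_pos]; exact_mod_cast hv.2
  simp only [cusumCoeff]
  rw [sum_ite_lt_eq hv.2.le, (sqrt_mul_cusum hv).1, (sqrt_mul_cusum hv).2]
  field_simp
  ring

/-- The CUSUM at `v` of the unit step following time `η`. -/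
noncomputable def stepCusum (n η v : ℕ) : ℝ :=
  ∑ t : Fin n, cusumCoeff v t * if t.val < η then 0 else 1

lemma sum_cusumCoeff_mul_step {v η : ℕ} (hv : v ∈ Set.Ioo 0 n) (α β : ℝ) :
    ∑ t : Fin n, cusumCoeff v t * (if t.val < η then α else β) = (β - α) * stepCusum n η v := by
  have : ∀ t : Fin n, cusumCoeff v t * (if t.val < η then α else β)
      = cusumCoeff v t * α + (β - α) * (cusumCoeff v t * if t.val < η then 0 else 1) := by
    intro t
    split_ifs <;> ring
  simp_rw [this]
  rw [Finset.sum_add_distrib, ← Finset.sum_mul, sum_cusumCoeff hv, ← Finset.mul_sum, stepCusum]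
  ring

/-- The contrast at `η` is itself a two-valued function jumping at `η`. Modulo constants, which the
contrast at `v` annihilates, the unit step is `stepCusum n η η` times it. -/
lemma stepCusum_mul_sum_cusumCoeff_mul {v η : ℕ} (hv : v ∈ Set.Ioo 0 n) (hη : η ∈ Set.Ioo 0 n) :
    stepCusum n η η * ∑ t : Fin n, cusumCoeff v t * cusumCoeff η t = stepCusum n η v := by
  have h1 := sum_cusumCoeff_mul_step (η := η) hv (√(((n : ℝ) - η) / (n * η)))
    (-√((η : ℝ) / (n * ((n : ℝ) - η))))
  have h2 := sum_cusumCoeff_mul_step (η := η) hη (√(((n : ℝ) - η) / (n * η)))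
    (-√((η : ℝ) / (n * ((n : ℝ) - η))))
  have h3 := sum_cusumCoeff_sq hη
  simp only [sq] at h3
  change ∑ t : Fin n, cusumCoeff v t * cusumCoeff η t = _ at h1
  change ∑ t : Fin n, cusumCoeff η t * cusumCoeff η t = _ at h2
  rw [h3] at h2
  rw [h1, ← mul_assoc, mul_comm (stepCusum n η η), ← h2, one_mul]

/-- This is Pythagoras: `b_v c_v` is the orthogonal projection of the centred step `b_η c_η` onto
the unit vector `c_v`. It identifies the variance of the cross term with the drop in signal energy.
-/
lemma sum_sq_stepCusum_mul_sub {v η : ℕ} (hv : v ∈ Set.Ioo 0 n) (hη : η ∈ Set.Ioo 0 n) :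
    ∑ t : Fin n, (stepCusum n η v * cusumCoeff v t - stepCusum n η η * cusumCoeff η t) ^ 2
      = stepCusum n η η ^ 2 - stepCusum n η v ^ 2 := by
  have : ∀ t : Fin n, (stepCusum n η v * cusumCoeff v t - stepCusum n η η * cusumCoeff η t) ^ 2
      = stepCusum n η v ^ 2 * cusumCoeff v t ^ 2 + stepCusum n η η ^ 2 * cusumCoeff η t ^ 2
        - 2 * stepCusum n η v * stepCusum n η η * (cusumCoeff v t * cusumCoeff η t) := by
    intro t
    ring
  simp_rw [this]
  rw [Finset.sum_sub_distrib, Finset.sum_add_distrib, ← Finset.mul_sum, ← Finset.mul_sum,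
    ← Finset.mul_sum, sum_cusumCoeff_sq hv, sum_cusumCoeff_sq hη]
  have := stepCusum_mul_sum_cusumCoeff_mul hv hη
  linear_combination (-2 * stepCusum n η v) * this

lemma stepCusum_sq_of_le {v η : ℕ} (hv : v ∈ Set.Ioo 0 n) (hη : η < n) (h : v ≤ η) :
    stepCusum n η v ^ 2 = v * (n - η) ^ 2 / (n * (n - v)) := by
  have h0' : (0 : ℝ) < v := by exact_mod_cast hv.1
  have h1' : (0 : ℝ) < n - v := by rw [sub_pos]; exact_mod_cast hv.2
  have h2' : (0 : ℝ) < n := by linarith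
  have : stepCusum n η v = -√((v : ℝ) / (n * ((n : ℝ) - v))) * (n - η) := by
    have h1 : ∀ t : Fin n, cusumCoeff v t * (if t.val < η then (0 : ℝ) else 1)
        = if t.val < η then 0 else -√((v : ℝ) / (n * ((n : ℝ) - v))) := by
      intro t
      by_cases ht : t.val < η
      · simp [ht]
      · simp [ht, cusumCoeff, show ¬ t.val < v by omega]
    rw [stepCusum, Finset.sum_congr rfl fun t _ => h1 t, sum_ite_lt_eq hη.le]
    ring
  rw [this, mul_pow, neg_sq, Real.sq_sqrt (by positivity)]
  ring

lemma stepCusum_sq_of_ge {v η : ℕ} (hv : v ∈ Set.Ioo 0 n) (hη : η < n) (h : η ≤ v) :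
    stepCusum n η v ^ 2 = η ^ 2 * (n - v) / (n * v) := by
  have h0' : (0 : ℝ) < v := by exact_mod_cast hv.1
  have h1' : (0 : ℝ) < n - v := by rw [sub_pos]; exact_mod_cast hv.2
  have h2' : (0 : ℝ) < n := by linarith
  have : stepCusum n η v = -√(((n : ℝ) - v) / (n * v)) * η := by
    -- For `η ≤ v` the complementary step `1_{t < η}` meets only the left-hand coefficients; passing
    -- to it changes just the sign.
    have h1 : ∀ t : Fin n, cusumCoeff v t * (if t.val < η then (1 : ℝ) else 0)
        = if t.val < η then √(((n : ℝ) - v) / (n * v)) else 0 := by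
      intro t
      by_cases ht : t.val < η
      · simp [ht, cusumCoeff, show t.val < v by omega]
      · simp [ht]
    have h2 := sum_cusumCoeff_mul_step (η := η) hv 1 0
    rw [Finset.sum_congr rfl fun t _ => h1 t, sum_ite_lt_eq hη.le] at h2
    linarith
  rw [this, mul_pow, neg_sq, Real.sq_sqrt (by positivity)]
  ring

/-- On each side of `η` the drop has the form `xy/(x + y)`, where `x = |v - η|` and `y` is `n - η`
or `η`. Such a quotient is at least `min x y / 2`. -/
lemma half_min_le_stepCusum_sq_sub {v η : ℕ} (hv : v ∈ Set.Ioo 0 n) (hη : η ∈ Set.Ioo 0 n) :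
    min |(v : ℝ) - η| ((min η (n - η) : ℕ) : ℝ) / 2
      ≤ stepCusum n η η ^ 2 - stepCusum n η v ^ 2 := by
  have h0' : (0 : ℝ) < v := by exact_mod_cast hv.1
  have h1' : (0 : ℝ) < n - v := by rw [sub_pos]; exact_mod_cast hv.2
  have h2' : (0 : ℝ) < n := by linarith
  have h3' : (0 : ℝ) < η := by exact_mod_cast hη.1
  have h4' : (0 : ℝ) < n - η := by rw [sub_pos]; exact_mod_cast hη.2
  rw [Nat.cast_min, Nat.cast_sub hη.2.le]
  rcases le_total v η with h | h
  · have hd : (0 : ℝ) ≤ η - v := by rw [sub_nonneg]; exact_mod_cast h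
    rw [stepCusum_sq_of_le hη hη.2 le_rfl, stepCusum_sq_of_le hv hη.2 h,
      abs_sub_comm, abs_of_nonneg hd]
    have heq : (η : ℝ) * (n - η) ^ 2 / (n * (n - η)) - v * (n - η) ^ 2 / (n * (n - v))
        = (n - η) * (η - v) / (n - v) := by
      field_simp
      ring
    rw [heq, le_div_iff₀ h1']
    rcases le_total ((η : ℝ) - v) (n - η) with h5 | h5
    · have : min ((η : ℝ) - v) (min (η : ℝ) (n - η)) ≤ η - v := min_le_left _ _
      nlinarith
    · have : min ((η : ℝ) - v) (min (η : ℝ) (n - η)) ≤ n - η :=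
        (min_le_right _ _).trans (min_le_right _ _)
      nlinarith
  · have hd : (0 : ℝ) ≤ v - η := by rw [sub_nonneg]; exact_mod_cast h
    rw [stepCusum_sq_of_ge hη hη.2 le_rfl, stepCusum_sq_of_ge hv hη.2 h, abs_of_nonneg hd]
    have heq : (η : ℝ) ^ 2 * (n - η) / (n * η) - η ^ 2 * (n - v) / (n * v)
        = η * (v - η) / v := by
      field_simp
      ring
    rw [heq, le_div_iff₀ h0']
    rcases le_total ((v : ℝ) - η) η with h5 | h5
    · have : min ((v : ℝ) - η) (min (η : ℝ) (n - η)) ≤ v - η := min_le_left _ _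
      nlinarith
    · have : min ((v : ℝ) - η) (min (η : ℝ) (n - η)) ≤ η :=
        (min_le_right _ _).trans (min_le_left _ _)
      nlinarith

end Cusum

section Mean

variable {n p : ℕ} {μ : Fin n → EuclideanSpace ℝ (Fin p)} {η : ℕ}

lemma IsSingleChangepoint.mean_eq (h : IsSingleChangepoint μ η) (t : Fin n) :
    μ t = if t.val < η then μ ⟨η - 1, (Nat.sub_le η 1).trans_lt h.lt⟩ else μ ⟨η, h.lt⟩ := by
  have hstep : ∀ v : ℕ, ∀ hv : v + 1 < n, v + 1 ≠ η → μ ⟨v, by omega⟩ = μ ⟨v + 1, hv⟩ := by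
    intro v hv hne
    by_contra hcon
    exact hne ((h.change_iff (v + 1) (by omega) hv).mp hcon)
  have hpos := h.pos
  have hleft : ∀ d v : ℕ, ∀ hv : v < n, v + d = η - 1 →
      μ ⟨v, hv⟩ = μ ⟨η - 1, (Nat.sub_le η 1).trans_lt h.lt⟩ := by
    intro d
    induction d with
    | zero =>
      intro v hv hvd
      congr 2
    | succ d ih =>
      intro v hv hvd
      have hlt := h.lt
      rw [hstep v (by omega) (by omega)]
      exact ih (v + 1) (by omega) (by omega)
  have hright : ∀ d : ℕ, ∀ hv : η + d < n, μ ⟨η + d, hv⟩ = μ ⟨η, h.lt⟩ := by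
    intro d
    induction d with
    | zero =>
      intro hv
      rfl
    | succ d ih =>
      intro hv
      rw [← ih (by omega)]
      exact (hstep (η + d) hv (by omega)).symm
  split_ifs with ht
  · exact hleft (η - 1 - t.val) t.val t.isLt (by omega)
  · have := hright (t.val - η) (by omega)
    simpa [Nat.add_sub_cancel' (not_lt.mp ht)] using this

lemma IsSingleChangepoint.cusum_mean (h : IsSingleChangepoint μ η) {v : ℕ}
    (hv : v ∈ Set.Ioo 0 n) (i : Fin p) :
    ∑ t : Fin n, cusumCoeff v t * μ t i = stepCusum n η v * h.jump i := by
  have : ∀ t, cusumCoeff v t * μ t i = cusumCoeff v t * (if t.val < η then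
      μ ⟨η - 1, (Nat.sub_le η 1).trans_lt h.lt⟩ i else μ ⟨η, h.lt⟩ i) := by
    intro t
    rw [h.mean_eq t]
    split_ifs <;> rfl
  simp_rw [this]
  rw [sum_cusumCoeff_mul_step hv, IsSingleChangepoint.jump]
  simp [mul_comm]

lemma IsSingleChangepoint.jump_ne_zero (h : IsSingleChangepoint μ η) : h.jump ≠ 0 := by
  have := (h.change_iff η h.pos h.lt).mpr rfl
  rw [IsSingleChangepoint.jump, sub_ne_zero]
  exact this.symm

end Mean

end MeanChange

/-! ### The logarithmic factor, thresholds and penalties in the two regimes. -/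

namespace MeanChange

section Rates

variable {n p t : ℕ}

/-- The logarithmic factor `log (e p log n / t²)`. -/
noncomputable def logFactor (n p t : ℕ) : ℝ :=
  Real.log (Real.exp 1 * p * Real.log n / (t : ℝ) ^ 2)

lemma one_half_le_log (hn : 2 ≤ n) : 1 / 2 ≤ Real.log n := by
  have h : Real.log 2 ≤ Real.log n := by
    gcongr
    exact_mod_cast hn
  linarith [Real.log_two_gt_d9]

lemma log_natCast_pos_of_two_le (hn : 2 ≤ n) : 0 < Real.log n := by linarith [one_half_le_log hn]

lemma sq_le_of_le_sqrt (hn : 2 ≤ n) (h : (t : ℝ) ≤ √(p * Real.log n)) :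
    (t : ℝ) ^ 2 ≤ p * Real.log n := by
  have := log_natCast_pos_of_two_le hn
  rw [← Real.sq_sqrt (show 0 ≤ p * Real.log n by positivity)]
  gcongr

lemma exp_logFactor (hn : 2 ≤ n) (hp : 0 < p) (ht : 0 < t) :
    Real.exp (logFactor n p t) = Real.exp 1 * p * Real.log n / (t : ℝ) ^ 2 := by
  have := log_natCast_pos_of_two_le hn
  have : (0 : ℝ) < p := by exact_mod_cast hp
  have : (0 : ℝ) < t := by exact_mod_cast ht
  rw [logFactor, Real.exp_log (by positivity)]

lemma one_le_logFactor (hn : 2 ≤ n) (hp : 0 < p) (ht : 0 < t)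
    (h : (t : ℝ) ≤ √(p * Real.log n)) : 1 ≤ logFactor n p t := by
  have h1 := sq_le_of_le_sqrt hn h
  have h2 : (0 : ℝ) < t := by exact_mod_cast ht
  rw [← Real.exp_le_exp, exp_logFactor hn hp ht, mul_assoc]
  rw [le_div_iff₀ (by positivity)]
  gcongr

lemma threshold_nonneg : 0 ≤ threshold n p t := by
  unfold threshold
  split_ifs <;> positivity

lemma threshold_sq (hn : 2 ≤ n) (hp : 0 < p) (ht : 0 < t)
    (h : (t : ℝ) ≤ √(p * Real.log n)) : threshold n p t ^ 2 = 4 * logFactor n p t := by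
  have := one_le_logFactor hn hp ht h
  rw [threshold, if_pos h, Real.sq_sqrt]
  · rfl
  · change 0 ≤ 4 * logFactor n p t
    linarith

lemma threshold_eq_zero (h : √(p * Real.log n) < t) : threshold n p t = 0 := by
  rw [threshold, if_neg h.not_ge]

lemma penaltyRate_of_gt (h : √(p * Real.log n) < t) :
    penaltyRate n p t = √(p * Real.log n) := by
  rw [penaltyRate, if_pos h.le]

lemma penaltyRate_of_lt (h : t < √(p * Real.log n)) :
    penaltyRate n p t = max (t * logFactor n p t) (Real.log n) := by
  rw [penaltyRate, if_neg h.not_ge]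
  rfl

lemma le_of_sqrt_lt (hn : 2 ≤ n) (ht : t ≤ p) (h : √(p * Real.log n) < t) :
    Real.log n ≤ p := by
  have := log_natCast_pos_of_two_le hn
  have h1 : p * Real.log n < (t : ℝ) ^ 2 := by
    rwa [Real.sqrt_lt' (by linarith [Real.sqrt_nonneg (p * Real.log n)])] at h
  have h2 : (t : ℝ) ≤ p := by exact_mod_cast ht
  have h3 : (0 : ℝ) ≤ t := by positivity
  by_contra hcon
  nlinarith

end Rates

/-! ### Tail bounds for thresholded sums of pure noise. -/

section Tails

variable {p : ℕ} {Ω : Type*} [MeasurableSpace Ω] {P : Measure Ω}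
  {Z : Ω → Fin p → ℝ}

lemma prob_sum_ge_le (hZ : HasLaw Z (Measure.pi fun _ : Fin p => gaussianReal 0 1) P)
    (A : Finset (Fin p)) {G : Fin p → ℝ → ℝ} (hG : ∀ i, Measurable (G i)) (b : Fin p → ℝ)
    (hint : ∀ i ∈ A, Integrable (fun z => Real.exp (G i z)) (gaussianReal 0 1))
    (hle : ∀ i ∈ A, ∫ z, Real.exp (G i z) ∂(gaussianReal 0 1) ≤ Real.exp (b i)) (x : ℝ) :
    P.real {ω | x ≤ ∑ i ∈ A, G i (Z ω i)} ≤ Real.exp (-x + ∑ i ∈ A, b i) := by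
  rw [hZ.measureReal_eq (p := fun z => x ≤ ∑ i ∈ A, G i (z i))]
  · exact prob_pi_sum_ge_le A G b hint hle x
  · exact measurableSet_le measurable_const
      (Finset.measurable_sum _ fun i _ => (hG i).comp (measurable_pi_apply i))

variable [IsProbabilityMeasure P]

lemma prob_abs_sum_ge_le (hZ : HasLaw Z (Measure.pi fun _ : Fin p => gaussianReal 0 1) P)
    (A : Finset (Fin p)) {F : ℝ → ℝ} (hF : Measurable F) {a : ℝ} (ha : 0 ≤ a)
    (hbound : ∀ z, |F z| ≤ {z : ℝ | a ≤ |z|}.indicator (fun z => 2 * z ^ 2 + 3) z)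
    (hzero : ∫ z, F z ∂(gaussianReal 0 1) = 0) {s : ℝ} (hs0 : 0 ≤ s) (hs : s ≤ 1 / 32) (x : ℝ) :
    P.real {ω | x ≤ |∑ i ∈ A, F (Z ω i)|}
      ≤ 2 * Real.exp (-(s * x) + 8192 * s ^ 2 * (p * Real.exp (-(a ^ 2) / 4))) := by
  have key : ∀ s' : ℝ, |s'| = s → P.real {ω | s * x ≤ ∑ i ∈ A, s' * F (Z ω i)}
      ≤ Real.exp (-(s * x) + 8192 * s ^ 2 * (p * Real.exp (-(a ^ 2) / 4))) := by
    intro s' hs'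
    have hm := mgf_truncated_le hF ha hbound hzero (hs'.trans_le hs)
    rw [← sq_abs, hs'] at hm
    refine (prob_sum_ge_le hZ A (G := fun _ z => s' * F z) (fun _ => by fun_prop)
      (fun _ => 8192 * s ^ 2 * Real.exp (-(a ^ 2) / 4)) (fun _ _ => hm.1)
      (fun _ _ => hm.2) (s * x)).trans ?_
    rw [Finset.sum_const, nsmul_eq_mul]
    have : (A.card : ℝ) ≤ p := by exact_mod_cast card_finset_fin_le A
    have hnn : 0 ≤ 8192 * s ^ 2 * Real.exp (-(a ^ 2) / 4) := by positivity
    refine Real.exp_le_exp.mpr ?_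
    nlinarith [mul_le_mul_of_nonneg_right this hnn]
  have hsub : {ω | x ≤ |∑ i ∈ A, F (Z ω i)|} ⊆ {ω | s * x ≤ ∑ i ∈ A, s * F (Z ω i)}
      ∪ {ω | s * x ≤ ∑ i ∈ A, (-s) * F (Z ω i)} := by
    intro ω (hω : x ≤ |∑ i ∈ A, F (Z ω i)|)
    rcases abs_cases (∑ i ∈ A, F (Z ω i)) with ⟨h, -⟩ | ⟨h, -⟩
    · left
      change s * x ≤ ∑ i ∈ A, s * F (Z ω i)
      rw [← Finset.mul_sum, ← h]
      gcongr
    · right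
      change s * x ≤ ∑ i ∈ A, (-s) * F (Z ω i)
      rw [← Finset.mul_sum, neg_mul, ← mul_neg, ← h]
      gcongr
  refine (measureReal_mono hsub).trans ((measureReal_union_le _ _).trans ?_)
  rw [two_mul]
  exact add_le_add (key s (abs_of_nonneg hs0)) (key (-s) (by rw [abs_neg, abs_of_nonneg hs0]))

lemma prob_thresholded_sum_of_gt {n t : ℕ} (hn : 2 ≤ n) (hp : 0 < p)
    (hZ : HasLaw Z (Measure.pi fun _ : Fin p => gaussianReal 0 1) P) (A : Finset (Fin p))
    (htp : t ≤ p) (ht : √(p * Real.log n) < t) :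
    P.real {ω | 768 * penaltyRate n p t ≤ |∑ i ∈ A, thresholded (threshold n p t) (Z ω i)|}
      ≤ 2 * Real.exp (-(8 * Real.log n)) := by
  have hlog := log_natCast_pos_of_two_le hn
  have hp' : (0 : ℝ) < p := by exact_mod_cast hp
  have hle := le_of_sqrt_lt hn htp ht
  -- The tilt is `u/32`. The linear term becomes `768/32 · log n = 24 log n` and the quadratic one
  -- `8192/32² · log n = 8 log n`, which leaves more than the `8 log n` needed.
  set u := √(Real.log n / p) with hu
  have hu1 : u ≤ 1 := by
    rw [hu, Real.sqrt_le_one, div_le_one hp']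
    exact hle
  have hu2 : u ^ 2 * p = Real.log n := by
    rw [hu, Real.sq_sqrt (by positivity)]
    field_simp
  have hu0 : 0 ≤ u := Real.sqrt_nonneg _
  have hu3 : u * √(p * Real.log n) = Real.log n := by
    rw [hu, ← Real.sqrt_mul (by positivity),
      show Real.log n / p * (p * Real.log n) = Real.log n ^ 2 by field_simp,
      Real.sqrt_sq hlog.le]
  have hbound : ∀ z, |thresholded (threshold n p t) z|
      ≤ {z : ℝ | threshold n p t ≤ |z|}.indicator (fun z => 2 * z ^ 2 + 3) z := fun z =>
    (abs_thresholded_le threshold_nonneg z).trans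
      (Set.indicator_le_indicator (by nlinarith [sq_nonneg z]))
  refine (prob_abs_sum_ge_le hZ A (measurable_thresholded _) threshold_nonneg hbound
    (integral_thresholded _) (s := 1 / 32 * u) (by positivity) (by linarith) _).trans ?_
  rw [threshold_eq_zero ht, penaltyRate_of_gt ht]
  simp only [ne_eq, OfNat.ofNat_ne_zero, not_false_eq_true, zero_pow, neg_zero, zero_div,
    Real.exp_zero, mul_one]
  gcongr
  have e1 : 1 / 32 * u * (768 * √(p * Real.log n)) = 24 * Real.log n := by
    linear_combination 24 * hu3
  have e2 : 8192 * (1 / 32 * u) ^ 2 * (p : ℝ) = 8 * Real.log n := by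
    rw [← hu2]; ring
  rw [e1, e2]
  linarith

/-- Thresholding reduces the variance proxy from `p` to `p e^{-a²/4} ≤ t²/log n`. The factor `t⁻¹ +
t/√(p log n)` decays geometrically from both ends of the dyadic grid, so the later union over the
grid costs only a constant. -/
lemma prob_thresholded_sum_of_lt {n t : ℕ} (hn : 2 ≤ n) (hp : 0 < p)
    (hZ : HasLaw Z (Measure.pi fun _ : Fin p => gaussianReal 0 1) P) (A : Finset (Fin p))
    (ht0 : 0 < t) (ht : t < √(p * Real.log n)) :
    P.real {ω | 768 * penaltyRate n p t ≤ |∑ i ∈ A, thresholded (threshold n p t) (Z ω i)|}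
      ≤ 2 * Real.exp (-(8 * Real.log n)) * ((t : ℝ)⁻¹ + t / √(p * Real.log n)) := by
  have hlog := log_natCast_pos_of_two_le hn
  have hlog2 := one_half_le_log hn
  have hp' : (0 : ℝ) < p := by exact_mod_cast hp
  have ht0' : (1 : ℝ) ≤ t := by exact_mod_cast ht0
  have ht1 : (0 : ℝ) < t := by linarith
  have hL := one_le_logFactor hn hp ht0 ht.le
  have hexpL := exp_logFactor hn hp ht0
  have hsq := sq_le_of_le_sqrt hn ht.le
  have hT2 := Real.sq_sqrt (show 0 ≤ (p : ℝ) * Real.log n by positivity)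
  have hasq := threshold_sq hn hp ht0 ht.le
  have hr := penaltyRate_of_lt ht
  set L := logFactor n p t with hLdef
  set l := Real.log n with hl
  set T := √(p * l) with hT
  set r := penaltyRate n p t with hrdef
  have hTpos : 0 < T := by linarith
  have hr1 : t * L ≤ r := hr ▸ le_max_left _ _
  have hr2 : l ≤ r := hr ▸ le_max_right _ _
  have hB : (p : ℝ) * Real.exp (-(threshold n p t ^ 2) / 4) ≤ t ^ 2 / l := by
    have : Real.exp (-(threshold n p t ^ 2) / 4) = (Real.exp L)⁻¹ := by
      rw [hasq, ← Real.exp_neg]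
      ring_nf
    rw [this, hexpL]
    have h1 : 1 ≤ Real.exp 1 := Real.one_le_exp (by norm_num)
    have : (p : ℝ) * (Real.exp 1 * p * l / t ^ 2)⁻¹ = t ^ 2 / l / Real.exp 1 := by
      field_simp
    rw [this]
    exact div_le_self (by positivity) h1
  have hbound : ∀ z, |thresholded (threshold n p t) z|
      ≤ {z : ℝ | threshold n p t ≤ |z|}.indicator (fun z => 2 * z ^ 2 + 3) z := fun z =>
    (abs_thresholded_le threshold_nonneg z).trans
      (Set.indicator_le_indicator (by nlinarith [sq_nonneg z]))
  have htail := fun s hs0 hs => prob_abs_sum_ge_le hZ A (measurable_thresholded _)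
    threshold_nonneg hbound (integral_thresholded _) (s := s) hs0 hs (768 * r)
  have hinv : 0 ≤ (t : ℝ)⁻¹ := by positivity
  have hquo : 0 ≤ t / T := by positivity
  -- The optimal tilt is of order `L log n / t`, capped at the admissible `1/32`. The capped case
  -- leaves a spare `e^{-t} ≤ 1/t`, the other a spare `e^{-L/2} ≤ t/T`.
  rcases le_total (t : ℝ) (L * l) with hcase | hcase
  · refine (htail (1 / 32) (by norm_num) le_rfl).trans ?_
    have h1 : (t : ℝ) ^ 2 / l ≤ t * L := by
      rw [div_le_iff₀ hlog]
      nlinarith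
    have h2 : Real.exp (-(t : ℝ)) ≤ (t : ℝ)⁻¹ := by
      rw [Real.exp_neg]
      gcongr
      linarith [Real.add_one_le_exp (t : ℝ)]
    calc 2 * Real.exp (-(1 / 32 * (768 * r)) + 8192 * (1 / 32) ^ 2
          * (p * Real.exp (-(threshold n p t ^ 2) / 4)))
        ≤ 2 * Real.exp (-(8 * l) + -t) := by
          refine mul_le_mul_of_nonneg_left (Real.exp_le_exp.mpr ?_) (by norm_num)
          have : (t : ℝ) ≤ t * L := le_mul_of_one_le_right ht1.le hL
          linarith
      _ = 2 * Real.exp (-(8 * l)) * Real.exp (-(t : ℝ)) := by rw [Real.exp_add]; ring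
      _ ≤ _ := by
          gcongr
          linarith
  · have hLl : 0 ≤ L * l := by positivity
    refine (htail (1 / 32 * (L * l / t)) (by positivity) ?_).trans ?_
    · have : L * l / t ≤ 1 := by rwa [div_le_one ht1]
      linarith
    have h1 : L ^ 2 * l ≤ L * l / t * r := by
      rw [div_mul_eq_mul_div, le_div_iff₀ ht1]
      nlinarith
    have h2 : 8192 * (1 / 32 * (L * l / t)) ^ 2 * (p * Real.exp (-(threshold n p t ^ 2) / 4))
        ≤ 8 * (L ^ 2 * l) := by
      calc _ ≤ 8192 * (1 / 32 * (L * l / t)) ^ 2 * (t ^ 2 / l) := by gcongr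
        _ = _ := by field_simp; ring
    have h3 : 8 * l + L / 2 ≤ 16 * (L ^ 2 * l) := by nlinarith [mul_pos hlog (zero_lt_one.trans_le hL)]
    have h4 : Real.exp (-(L / 2)) ≤ t / T := by
      have h5 : (T / t) ^ 2 ≤ Real.exp (L / 2) ^ 2 := by
        rw [← Real.exp_nat_mul, div_pow, hT2]
        push_cast
        rw [mul_div_cancel₀ _ (by norm_num), hexpL]
        gcongr
        exact le_mul_of_one_le_left hp'.le (Real.one_le_exp (by norm_num))
      have h6 := abs_le_of_sq_le_sq' h5 (Real.exp_pos _).le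
      rw [Real.exp_neg, ← inv_div T]
      exact inv_anti₀ (by positivity) h6.2
    calc 2 * Real.exp (-(1 / 32 * (L * l / t) * (768 * r)) + 8192 * (1 / 32 * (L * l / t)) ^ 2
          * (p * Real.exp (-(threshold n p t ^ 2) / 4)))
        ≤ 2 * Real.exp (-(8 * l) + -(L / 2)) := by
          refine mul_le_mul_of_nonneg_left (Real.exp_le_exp.mpr ?_) (by norm_num)
          linarith
      _ = 2 * Real.exp (-(8 * l)) * Real.exp (-(L / 2)) := by rw [Real.exp_add]; ring
      _ ≤ _ := by
          gcongr
          linarith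

end Tails

end MeanChange

namespace MeanChange

/-- The second alternative arises because `Nat.log 2 0 = 0`: the grid contains `1` even when `T <
1`. -/
lemma two_pow_log_floor_le {T : ℝ} {j : ℕ} (hT : 0 ≤ T)
    (hj : j ∈ Finset.range (Nat.log 2 ⌊T⌋₊ + 1)) : (2 : ℝ) ^ j ≤ T ∨ (j = 0 ∧ T < 1) := by
  rw [Finset.mem_range, Nat.lt_succ_iff] at hj
  rcases eq_or_ne ⌊T⌋₊ 0 with h0 | h0
  · right
    rw [h0] at hj
    exact ⟨by simpa using hj, Nat.floor_eq_zero.mp h0⟩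
  · left
    have h1 : 2 ^ j ≤ ⌊T⌋₊ :=
      (Nat.pow_le_pow_right (by norm_num) hj).trans (Nat.pow_log_le_self 2 h0)
    have h2 : ((2 ^ j : ℕ) : ℝ) ≤ T := (Nat.le_floor_iff hT).mp h1
    exact_mod_cast h2

section Tails

variable {p : ℕ} {Ω : Type*} [MeasurableSpace Ω] {P : Measure Ω} [IsProbabilityMeasure P]
  {Z : Ω → Fin p → ℝ}

/-- The grid point `p` contributes at most `4E`. The dyadic points contribute `2E` times two
geometric series, each at most `2`. -/
lemma prob_exists_grid_thresholded_sum {n : ℕ} (hn : 2 ≤ n) (hp : 0 < p)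
    (hZ : HasLaw Z (Measure.pi fun _ : Fin p => gaussianReal 0 1) P) (A : Finset (Fin p)) :
    P.real {ω | ∃ t ∈ sparsityGrid n p, 768 * penaltyRate n p t
        < |∑ i ∈ A, thresholded (threshold n p t) (Z ω i)|}
      ≤ 12 * Real.exp (-(8 * Real.log n)) := by
  set E := Real.exp (-(8 * Real.log n)) with hE
  have hEpos : 0 < E := Real.exp_pos _
  set T := √(p * Real.log n) with hT
  have hT0 : 0 ≤ T := Real.sqrt_nonneg _
  set J := Nat.log 2 ⌊T⌋₊ with hJ
  set B : ℕ → Set Ω := fun t => {ω | 768 * penaltyRate n p t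
        ≤ |∑ i ∈ A, thresholded (threshold n p t) (Z ω i)|} with hB
  have hlt : ∀ t : ℕ, 0 < t → t < T → P.real (B t) ≤ 2 * E * ((t : ℝ)⁻¹ + t / T) :=
    fun t ht0 ht => prob_thresholded_sum_of_lt hn hp hZ A ht0 ht
  have hgt : ∀ t : ℕ, t ≤ p → T < t → P.real (B t) ≤ 2 * E :=
    fun t htp ht => prob_thresholded_sum_of_gt hn hp hZ A htp ht
  have hpB : P.real (B p) ≤ 4 * E := by
    rcases lt_or_gt_of_ne (natCast_ne_sqrt_mul_log (n := n) (by omega) p hp.ne') with h | h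
    · refine (hlt p hp h).trans ?_
      have h1 : (p : ℝ)⁻¹ ≤ 1 := inv_le_one_of_one_le₀ (by exact_mod_cast hp)
      have h2 : p / T ≤ 1 := (div_le_one (by linarith [(Nat.cast_nonneg p : (0 : ℝ) ≤ p)])).mpr h.le
      nlinarith
    · exact (hgt p le_rfl h).trans (by linarith)
  have hjB : ∀ j ∈ Finset.range (J + 1),
      P.real (B (2 ^ j)) ≤ 2 * E * ((1 / 2) ^ j + 2 ^ j / 2 ^ J) := by
    intro j hj
    rcases lt_or_gt_of_ne (natCast_ne_sqrt_mul_log (n := n) (by omega) p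
      (pow_ne_zero j two_ne_zero)) with h | h
    · refine (hlt _ (by positivity) h).trans ?_
      push_cast at h ⊢
      have hJT : (2 : ℝ) ^ J ≤ T := by
        rcases two_pow_log_floor_le hT0 (j := J) (by simp [hJ]) with h1 | ⟨h1, h2⟩
        · exact h1
        · have : (1 : ℝ) ≤ 2 ^ j := one_le_pow₀ (by norm_num)
          linarith
      rw [one_div, inv_pow]
      gcongr
    -- A dyadic grid point above `T` can only be `1` with `T < 1`; its threshold is zero and the
    -- dense bound applies.
    · rcases two_pow_log_floor_le hT0 hj with h1 | ⟨rfl, h2⟩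
      · push_cast at h
        exact absurd h1 h.not_ge
      · refine (hgt _ (by rw [pow_zero]; omega) h).trans ?_
        have : (0 : ℝ) ≤ 2 ^ 0 / 2 ^ J := by positivity
        rw [pow_zero]
        nlinarith
  have hsub : {ω | ∃ t ∈ sparsityGrid n p, 768 * penaltyRate n p t
        < |∑ i ∈ A, thresholded (threshold n p t) (Z ω i)|}
      ⊆ B p ∪ ⋃ j ∈ Finset.range (J + 1), B (2 ^ j) := by
    rintro ω ⟨t, ht, hω⟩
    rw [sparsityGrid, Finset.mem_insert, Finset.mem_image] at ht
    rcases ht with rfl | ⟨j, hj, rfl⟩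
    · exact Or.inl hω.le
    · right
      simp only [Set.mem_iUnion]
      exact ⟨j, hj, hω.le⟩
  have hs1 : ∑ j ∈ Finset.range (J + 1), (1 / 2 : ℝ) ^ j ≤ 2 := by
    have := sum_geometric_two_le (J + 1)
    simpa using this
  have hs2 : ∑ j ∈ Finset.range (J + 1), (2 : ℝ) ^ j / 2 ^ J ≤ 2 := by
    rw [← Finset.sum_div, geom_sum_eq (by norm_num), div_le_iff₀ (by positivity), pow_succ]
    linarith
  calc _ ≤ P.real (B p ∪ ⋃ j ∈ Finset.range (J + 1), B (2 ^ j)) := measureReal_mono hsub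
    _ ≤ P.real (B p) + P.real (⋃ j ∈ Finset.range (J + 1), B (2 ^ j)) := measureReal_union_le _ _
    _ ≤ 4 * E + ∑ j ∈ Finset.range (J + 1), P.real (B (2 ^ j)) :=
        add_le_add hpB (measureReal_biUnion_finset_le _ _)
    _ ≤ 4 * E + ∑ j ∈ Finset.range (J + 1), 2 * E * ((1 / 2) ^ j + 2 ^ j / 2 ^ J) :=
        add_le_add_right (Finset.sum_le_sum hjB) _
    _ ≤ 12 * E := by
        rw [← Finset.mul_sum, Finset.sum_add_distrib]
        nlinarith

lemma prob_sum_sq_ge_le (hZ : HasLaw Z (Measure.pi fun _ : Fin p => gaussianReal 0 1) P)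
    (A : Finset (Fin p)) (y : ℝ) :
    P.real {ω | 8 / 3 * (A.card + y) ≤ ∑ i ∈ A, Z ω i ^ 2} ≤ Real.exp (-y) := by
  have h := prob_sum_ge_le hZ A (G := fun _ z => 3 / 8 * z ^ 2) (fun _ => by fun_prop)
    (fun _ => 1) (fun _ _ => integrable_exp_sq_gaussianReal) (fun _ _ => by
      rw [integral_exp_sq_gaussianReal]
      linarith [Real.add_one_le_exp (1 : ℝ)]) (A.card + y)
  refine (measureReal_mono (fun ω hω => ?_)).trans (h.trans (le_of_eq ?_))
  · change A.card + y ≤ ∑ i ∈ A, 3 / 8 * Z ω i ^ 2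
    have hω : 8 / 3 * (A.card + y) ≤ ∑ i ∈ A, Z ω i ^ 2 := hω
    rw [← Finset.mul_sum]
    linarith
  · simp

end Tails

/-! ### What thresholding discards, and its lower tail uniformly in the mean. -/

/-- The part of `x² - 1` not captured by the thresholded square. -/
noncomputable def belowThreshold (a x : ℝ) : ℝ := x ^ 2 - 1 - thresholded a x

/-- The function equals `x² - 1` below the threshold and the constant `ν_a - 1` above it. Since `ν_a
≥ a²`, the jump at `|x| = a` is upwards. -/
lemma belowThreshold_mono {a : ℝ} (ha : 0 ≤ a) {x y : ℝ} (h : |x| ≤ |y|) :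
    belowThreshold a x ≤ belowThreshold a y := by
  have hxy : x ^ 2 ≤ y ^ 2 := sq_le_sq.mpr h
  have hc := sq_le_centering ha
  unfold belowThreshold thresholded
  split_ifs with h1 h2 h2
  · linarith
  · exact absurd (h1.trans h) h2
  · have : x ^ 2 ≤ a ^ 2 := by
      rw [sq_le_sq, abs_of_nonneg ha]
      exact (not_le.mp h1).le
    linarith
  · linarith

lemma neg_one_le_belowThreshold {a : ℝ} (ha : 0 ≤ a) (x : ℝ) : -1 ≤ belowThreshold a x := by
  refine le_trans ?_ (belowThreshold_mono ha (x := 0) (by simp))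
  have hc := sq_le_centering ha
  have : 0 ≤ centering a := (sq_nonneg a).trans hc
  unfold belowThreshold thresholded
  split_ifs
  · linarith
  · norm_num

lemma measurable_belowThreshold (a : ℝ) : Measurable (belowThreshold a) :=
  ((measurable_id.pow_const 2).sub_const 1).sub (measurable_thresholded a)

/-- The exponential is bounded and nonincreasing in `|z|`, so shifting the Gaussian only decreases
its integral. The centred case thus controls every mean `m`. -/
lemma integral_exp_neg_belowThreshold_le {a : ℝ} (ha : 0 ≤ a) {s : ℝ} (hs0 : 0 ≤ s)
    (hs : s ≤ 1 / 32) (m : ℝ) :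
    Integrable (fun z => Real.exp (-s * belowThreshold a (m + z))) (gaussianReal 0 1) ∧
    ∫ z, Real.exp (-s * belowThreshold a (m + z)) ∂(gaussianReal 0 1)
      ≤ Real.exp (8192 * s ^ 2) := by
  have hmeas := measurable_belowThreshold a
  have hb : ∀ z, |Real.exp (-s * belowThreshold a z)| ≤ Real.exp s := by
    intro z
    rw [abs_of_pos (Real.exp_pos _)]
    refine Real.exp_le_exp.mpr ?_
    nlinarith [neg_one_le_belowThreshold ha z]
  have hthr : Integrable (thresholded a) (gaussianReal 0 1) := by
    refine Integrable.mono' (g := fun z => z ^ 2 + 2)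
      (integrable_sq_gaussianReal.add (integrable_const _))
      (measurable_thresholded a).aestronglyMeasurable
      (ae_of_all _ fun z => (abs_thresholded_le ha z).trans ?_)
    exact Set.indicator_le_self' (fun _ _ => by positivity) z
  have hzero : ∫ z, belowThreshold a z ∂(gaussianReal 0 1) = 0 := by
    unfold belowThreshold
    rw [integral_sub (f := fun z => z ^ 2 - 1)
      (integrable_sq_gaussianReal.sub (integrable_const _)) hthr,
      integral_sub integrable_sq_gaussianReal (integrable_const _), integral_thresholded,
      integral_sq_gaussianReal]
    simp
  have hbound : ∀ z, |belowThreshold a z|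
      ≤ {z : ℝ | 0 ≤ |z|}.indicator (fun z => 2 * z ^ 2 + 3) z := by
    intro z
    rw [Set.indicator_of_mem (show z ∈ {z : ℝ | 0 ≤ |z|} from abs_nonneg z)]
    have h1 : |thresholded a z| ≤ z ^ 2 + 2 := (abs_thresholded_le ha z).trans
      (Set.indicator_le_self' (fun _ _ => by positivity) z)
    rw [abs_le] at h1 ⊢
    unfold belowThreshold
    constructor <;> nlinarith [sq_nonneg z]
  have hm := mgf_truncated_le hmeas le_rfl hbound hzero (s := -s)
    (by rwa [abs_neg, abs_of_nonneg hs0])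
  constructor
  · refine Integrable.mono' (integrable_const (Real.exp s))
      (by fun_prop : Measurable _).aestronglyMeasurable
      (ae_of_all _ fun z => hb (m + z))
  · refine (integral_shift_le (φ := fun z => Real.exp (-s * belowThreshold a z)) (by fun_prop) hb
      (fun x y hxy => Real.exp_le_exp.mpr ?_) m).trans (hm.2.trans (le_of_eq ?_))
    · nlinarith [belowThreshold_mono ha hxy]
    · simp

section Tails

variable {p : ℕ} {Ω : Type*} [MeasurableSpace Ω] {P : Measure Ω} [IsProbabilityMeasure P]
  {Z : Ω → Fin p → ℝ}

/-- `log n ∨ log log (e p)`. -/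
noncomputable def logMax (n p : ℕ) : ℝ :=
  max (Real.log n) (Real.log (Real.log (Real.exp 1 * p)))

lemma log_exp_one_mul (hp : 0 < p) : Real.log (Real.exp 1 * p) = 1 + Real.log p := by
  rw [Real.log_mul (Real.exp_pos _).ne' (by positivity), Real.log_exp]

lemma logMax_le {n : ℕ} (hp : 0 < p) (h : Real.log n ≤ p) : logMax n p ≤ p := by
  refine max_le h ?_
  have hp' : (0 : ℝ) < p := by exact_mod_cast hp
  have h1 : 0 ≤ Real.log p := Real.log_natCast_nonneg p
  have h2 := Real.log_le_sub_one_of_pos hp'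
  have h3 := Real.log_le_sub_one_of_pos (show 0 < Real.log (Real.exp 1 * p) by
    rw [log_exp_one_mul hp]; linarith)
  rw [log_exp_one_mul hp] at h3 ⊢
  linarith

lemma prob_sum_belowThreshold_le {n : ℕ} (hn : 2 ≤ n) (hp : 0 < p) (hlogp : Real.log n ≤ p)
    (hZ : HasLaw Z (Measure.pi fun _ : Fin p => gaussianReal 0 1) P) (m : Fin p → ℝ)
    {a : ℝ} (ha : 0 ≤ a) :
    P.real {ω | ∑ i, belowThreshold a (m i + Z ω i) ≤ -(544 * √(p * logMax n p))}
      ≤ Real.exp (-(9 * logMax n p)) := by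
  have hlog := log_natCast_pos_of_two_le hn
  have hp' : (0 : ℝ) < p := by exact_mod_cast hp
  have hle := logMax_le hp hlogp
  have hpos : 0 < logMax n p := lt_max_of_lt_left hlog
  set H := logMax n p with hH
  set u := √(H / p) with hu
  have hu1 : u ≤ 1 := by
    rw [hu, Real.sqrt_le_one, div_le_one hp']
    exact hle
  have hu2 : u ^ 2 * p = H := by
    rw [hu, Real.sq_sqrt (by positivity)]
    field_simp
  have hu0 : 0 ≤ u := Real.sqrt_nonneg _
  have hu3 : u * √(p * H) = H := by
    rw [hu, ← Real.sqrt_mul (by positivity),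
      show H / p * (p * H) = H ^ 2 by field_simp, Real.sqrt_sq hpos.le]
  have hI := fun i => integral_exp_neg_belowThreshold_le ha (s := 1 / 32 * u) (by positivity)
    (by linarith) (m i)
  have hmeas := measurable_belowThreshold a
  have h := prob_sum_ge_le hZ Finset.univ
    (G := fun i z => -(1 / 32 * u) * belowThreshold a (m i + z)) (fun _ => by fun_prop)
    (fun _ => 8192 * (1 / 32 * u) ^ 2) (fun i _ => (hI i).1) (fun i _ => (hI i).2)
    (1 / 32 * u * (544 * √(p * H)))
  refine (measureReal_mono (fun ω hω => ?_)).trans (h.trans ?_)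
  · change _ ≤ ∑ i, -(1 / 32 * u) * belowThreshold a (m i + Z ω i)
    have hω : ∑ i, belowThreshold a (m i + Z ω i) ≤ -(544 * √(p * H)) := hω
    rw [← Finset.mul_sum]
    nlinarith
  · refine Real.exp_le_exp.mpr (le_of_eq ?_)
    rw [Finset.sum_const, nsmul_eq_mul, Finset.card_univ, Fintype.card_fin]
    -- Here `544/32 = 17` and `17 - 8 = 9`. Of the nine multiples of `logMax n p`, one pays for the
    -- number of grid points and eight remain.
    linear_combination 8 * hu2 - 17 * hu3

/-- The grid has at most about `2 log (ep)` points, and `log (ep) ≤ e^{logMax}`. This is the reason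
for the iterated logarithm in the dense rate. -/
lemma card_sparsityGrid_le {n : ℕ} (hn : 2 ≤ n) (hp : 0 < p) (hlogp : Real.log n ≤ p) :
    ((sparsityGrid n p).card : ℝ) ≤ 3 * Real.exp (logMax n p) := by
  have hlog := log_natCast_pos_of_two_le hn
  have hp' : (1 : ℝ) ≤ p := by exact_mod_cast hp
  set T := √(p * Real.log n) with hT
  have hTp : T ≤ p := by
    rw [hT, Real.sqrt_le_left (by positivity), sq]
    gcongr
  set J := Nat.log 2 ⌊T⌋₊ with hJ
  have hcard : ((sparsityGrid n p).card : ℝ) ≤ J + 2 := by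
    have h1 : (sparsityGrid n p).card ≤ J + 1 + 1 := by
      refine (Finset.card_insert_le _ _).trans (Nat.succ_le_succ ?_)
      exact Finset.card_image_le.trans (by simp [hJ, hT])
    exact_mod_cast h1
  have hlp : 0 ≤ Real.log p := Real.log_natCast_nonneg p
  have hJp : J * Real.log 2 ≤ Real.log p := by
    rcases two_pow_log_floor_le (Real.sqrt_nonneg (p * Real.log n)) (j := J)
      (by simp [hJ, hT]) with h1 | ⟨h1, -⟩
    · rw [← Real.log_pow]
      exact Real.log_le_log (by positivity) (h1.trans hTp)
    · rw [h1]
      simpa using hlp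
  have hJ2 : (J : ℝ) ≤ 2 * Real.log p := by
    nlinarith [Real.log_two_gt_d9, (Nat.cast_nonneg J : (0 : ℝ) ≤ J)]
  have hexp : 1 + Real.log p ≤ Real.exp (logMax n p) := by
    rw [← log_exp_one_mul hp, ← Real.log_le_iff_le_exp]
    · exact le_max_right _ _
    · rw [log_exp_one_mul hp]; linarith
  linarith

lemma prob_exists_grid_belowThreshold {n : ℕ} (hn : 2 ≤ n) (hp : 0 < p)
    (hlogp : Real.log n ≤ p)
    (hZ : HasLaw Z (Measure.pi fun _ : Fin p => gaussianReal 0 1) P) (m : Fin p → ℝ) :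
    P.real {ω | ∃ t ∈ sparsityGrid n p, ∑ i, belowThreshold (threshold n p t) (m i + Z ω i)
        ≤ -(544 * √(p * logMax n p))} ≤ 3 * Real.exp (-(8 * Real.log n)) := by
  have hsub : {ω | ∃ t ∈ sparsityGrid n p,
        ∑ i, belowThreshold (threshold n p t) (m i + Z ω i) ≤ -(544 * √(p * logMax n p))}
      ⊆ ⋃ t ∈ sparsityGrid n p, {ω |
        ∑ i, belowThreshold (threshold n p t) (m i + Z ω i) ≤ -(544 * √(p * logMax n p))} := by
    rintro ω ⟨t, ht, hω⟩
    simp only [Set.mem_iUnion]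
    exact ⟨t, ht, hω⟩
  refine (measureReal_mono hsub (measure_ne_top _ _)).trans ((measureReal_biUnion_finset_le _ _).trans ?_)
  refine (Finset.sum_le_sum fun t _ =>
    prob_sum_belowThreshold_le hn hp hlogp hZ m threshold_nonneg).trans ?_
  rw [Finset.sum_const, nsmul_eq_mul]
  calc _ ≤ 3 * Real.exp (logMax n p) * Real.exp (-(9 * logMax n p)) := by
        gcongr
        exact card_sparsityGrid_le hn hp hlogp
    _ = 3 * Real.exp (-(8 * logMax n p)) := by
        rw [mul_assoc, ← Real.exp_add]
        ring_nf
    _ ≤ _ := by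
        gcongr
        exact le_max_left _ _

end Tails

end MeanChange

/-! ### Deterministic comparison of the scores at `v` and at `η`. -/

namespace MeanChange

open scoped RealInnerProductSpace

section Rate

variable {n p k : ℕ}

lemma rate_of_lt (h : (k : ℝ) < √(p * Real.log n)) :
    rate n p k = max (k * logFactor n p k) (Real.log n) := by
  rw [rate, if_neg h.not_ge]
  rfl

lemma rate_of_gt (h : √(p * Real.log n) < k) : rate n p k = √(p * logMax n p) := by
  rw [rate, if_pos h.le]
  rfl

lemma log_le_rate (hn : 2 ≤ n) (hk : 0 < k) (hkp : k ≤ p) : Real.log n ≤ rate n p k := by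
  have hlog := log_natCast_pos_of_two_le hn
  rcases lt_or_gt_of_ne (natCast_ne_sqrt_mul_log (n := n) (by omega) p hk.ne') with h | h
  · rw [rate_of_lt h]
    exact le_max_right _ _
  · rw [rate_of_gt h]
    refine Real.le_sqrt_of_sq_le ?_
    have h1 := le_of_sqrt_lt hn hkp h
    have h2 : Real.log n ≤ logMax n p := le_max_left _ _
    nlinarith

end Rate

section Deterministic

variable {n p : ℕ}

lemma sparsityScore_eq (pen : ℕ → ℝ) (x : Fin n → EuclideanSpace ℝ (Fin p)) (v t : ℕ) :
    sparsityScore pen x v t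
      = ∑ i, thresholded (threshold n p t) (cusum v fun u => x u i) - pen t := rfl

lemma estimator_spec (hn : 2 ≤ n) (pen : ℕ → ℝ) (x : Fin n → EuclideanSpace ℝ (Fin p)) :
    estimator pen x ∈ Set.Ioo 0 n ∧
      ∀ w ∈ Set.Ioo 0 n, score pen x w ≤ score pen x (estimator pen x) := by
  have hne : {v : ℕ | v ∈ Set.Ioo 0 n ∧ ∀ w ∈ Set.Ioo 0 n, score pen x w ≤ score pen x v}.Nonempty := by
    obtain ⟨v, hv, hmax⟩ := Set.exists_max_image (Set.Ioo 0 n) (score pen x) (Set.finite_Ioo 0 n)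
      ⟨1, by simp; omega⟩
    exact ⟨v, hv, hmax⟩
  exact Nat.sInf_mem hne

lemma sum_sq_signal_add_noise_sub (A : Finset (Fin p)) (θ z z' : Fin p → ℝ) (b b' : ℝ)
    (hθ : ∀ i ∉ A, θ i = 0) :
    ∑ i ∈ A, (b * θ i + z i) ^ 2 - ∑ i ∈ A, (b' * θ i + z' i) ^ 2
      = (b ^ 2 - b' ^ 2) * ∑ i, θ i ^ 2 + 2 * ∑ i, (b * z i - b' * z' i) * θ i
        + ∑ i ∈ A, z i ^ 2 - ∑ i ∈ A, z' i ^ 2 := by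
  have h1 : ∑ i, θ i ^ 2 = ∑ i ∈ A, θ i ^ 2 :=
    (Finset.sum_subset (Finset.subset_univ A) fun i _ hi => by simp [hθ i hi]).symm
  have h2 : ∑ i, (b * z i - b' * z' i) * θ i = ∑ i ∈ A, (b * z i - b' * z' i) * θ i :=
    (Finset.sum_subset (Finset.subset_univ A) fun i _ hi => by simp [hθ i hi]).symm
  rw [h1, h2, Finset.mul_sum, Finset.mul_sum, ← Finset.sum_sub_distrib, ← Finset.sum_add_distrib,
    ← Finset.sum_add_distrib, ← Finset.sum_sub_distrib]
  exact Finset.sum_congr rfl fun i _ => by ring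

lemma thresholded_le_sq {a : ℝ} (ha : 0 ≤ a) (x : ℝ) : thresholded a x ≤ x ^ 2 := by
  have := (sq_nonneg a).trans (sq_le_centering ha)
  unfold thresholded
  split_ifs
  · linarith
  · positivity

lemma sq_sub_centering_le_thresholded {a : ℝ} (ha : 0 ≤ a) (x : ℝ) :
    x ^ 2 - centering a ≤ thresholded a x := by
  have h := sq_le_centering ha
  unfold thresholded
  split_ifs with hx
  · exact le_rfl
  · have : x ^ 2 ≤ a ^ 2 := by
      rw [sq_le_sq, abs_of_nonneg ha]
      exact (not_le.mp hx).le
    linarith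

/-- The witness is the largest power of two not exceeding `k`. As `k < 2t`, the logarithmic factor
grows by at most `log 4 ≤ 2`, hence at most triples. Then `ν_a ≤ 4 · 3L + 2 ≤ 14L`, where `L ≥ 1` is
the factor at `k`. -/
lemma exists_grid_near (hn : 2 ≤ n) (hp : 0 < p) {k : ℕ} (hk : 0 < k)
    (hkT : (k : ℝ) < √(p * Real.log n)) :
    ∃ t ∈ sparsityGrid n p, 0 < t ∧ (t : ℝ) < √(p * Real.log n) ∧
      k * centering (threshold n p t) ≤ 14 * rate n p k ∧
      penaltyRate n p t ≤ 3 * rate n p k := by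
  set j := Nat.log 2 k with hj
  have h1 : 2 ^ j ≤ k := Nat.pow_log_le_self 2 hk.ne'
  have h2 : k < 2 ^ (j + 1) := Nat.lt_pow_succ_log_self (by norm_num) k
  have h1' : ((2 ^ j : ℕ) : ℝ) ≤ k := by exact_mod_cast h1
  have h2' : (k : ℝ) < 2 * ((2 ^ j : ℕ) : ℝ) := by
    have : k < 2 * 2 ^ j := by rwa [pow_succ, mul_comm] at h2
    exact_mod_cast this
  have hpos : 0 < 2 ^ j := by positivity
  have htT := h1'.trans_lt hkT
  refine ⟨2 ^ j, ?_, hpos, htT, ?_⟩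
  · refine Finset.mem_insert_of_mem (Finset.mem_image_of_mem _ ?_)
    rw [Finset.mem_range, Nat.lt_succ_iff]
    exact Nat.log_mono_right (Nat.le_floor hkT.le)
  generalize 2 ^ j = t at *
  have hk' : (0 : ℝ) < k := by exact_mod_cast hk
  have ht' : (0 : ℝ) < t := by exact_mod_cast hpos
  have hL := one_le_logFactor hn hp hk hkT.le
  have hLt := one_le_logFactor hn hp hpos htT.le
  have hlog := log_natCast_pos_of_two_le hn
  have hp' : (0 : ℝ) < p := by exact_mod_cast hp
  have hLL : logFactor n p t ≤ 3 * logFactor n p k := by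
    have h4 : (4 : ℝ) ≤ Real.exp 2 := by
      have := Real.add_one_le_exp (1 : ℝ)
      rw [show (2 : ℝ) = 1 + 1 by norm_num, Real.exp_add]
      nlinarith
    have : logFactor n p t ≤ 2 + logFactor n p k := by
      rw [← Real.exp_le_exp, Real.exp_add, exp_logFactor hn hp hpos, exp_logFactor hn hp hk,
        ← mul_div_assoc, div_le_div_iff₀ (by positivity) (by positivity)]
      have hsq : (k : ℝ) ^ 2 ≤ 4 * t ^ 2 := by nlinarith
      have hX : 0 < Real.exp 1 * p * Real.log n := by positivity
      calc Real.exp 1 * p * Real.log n * (k : ℝ) ^ 2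
          ≤ Real.exp 1 * p * Real.log n * (4 * t ^ 2) := by gcongr
        _ ≤ Real.exp 1 * p * Real.log n * (Real.exp 2 * t ^ 2) := by gcongr
        _ = _ := by ring
    linarith
  have hrate := rate_of_lt hkT
  have hr1 : k * logFactor n p k ≤ rate n p k := hrate ▸ le_max_left _ _
  have hr2 : Real.log n ≤ rate n p k := hrate ▸ le_max_right _ _
  constructor
  · have hc := centering_le (threshold_nonneg (n := n) (p := p) (t := t))
    rw [threshold_sq hn hp hpos htT.le] at hc
    nlinarith
  · rw [penaltyRate_of_lt htT]
    refine max_le ?_ (by linarith)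
    calc (t : ℝ) * logFactor n p t ≤ k * (3 * logFactor n p k) := by gcongr
      _ ≤ _ := by linarith

/-- On the favourable noise event the score separates candidates from the changepoint: the sparse
regime. -/
lemma score_le_of_sparse (hn : 2 ≤ n) (hp : 0 < p) {S : Finset (Fin p)} (hS : 0 < S.card)
    (hST : (S.card : ℝ) < √(p * Real.log n)) (x : Fin n → EuclideanSpace ℝ (Fin p))
    {η v : ℕ} (θ z z' : Fin p → ℝ) {b b' : ℝ} (hθ : ∀ i ∉ S, θ i = 0)
    (hv : ∀ i, (cusum v fun u => x u i) = b * θ i + z i)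
    (hη : ∀ i, (cusum η fun u => x u i) = b' * θ i + z' i)
    (hz : ∀ t ∈ sparsityGrid n p,
      |∑ i ∈ Sᶜ, thresholded (threshold n p t) (z i)| ≤ 768 * penaltyRate n p t)
    (hz' : ∀ t ∈ sparsityGrid n p,
      |∑ i ∈ Sᶜ, thresholded (threshold n p t) (z' i)| ≤ 768 * penaltyRate n p t)
    (hchi : ∑ i ∈ S, z i ^ 2 ≤ 8 / 3 * (S.card + 8 * Real.log n))
    (hcross : ∑ i, (b * z i - b' * z' i) * θ i
      ≤ (b' ^ 2 - b ^ 2) * (∑ i, θ i ^ 2) / 4 + 16 * Real.log n) :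
    score (fun t => 768 * penaltyRate n p t) x v
      ≤ score (fun t => 768 * penaltyRate n p t) x η
        - (b' ^ 2 - b ^ 2) * (∑ i, θ i ^ 2) / 2 + 5000 * rate n p S.card := by
  have hsplit : ∀ t (c : Fin p → ℝ) (w : Fin p → ℝ) (β : ℝ), (∀ i, c i = β * θ i + w i) →
      ∑ i, thresholded (threshold n p t) (c i)
        = ∑ i ∈ S, thresholded (threshold n p t) (c i)
          + ∑ i ∈ Sᶜ, thresholded (threshold n p t) (w i) := by
    intro t c w β hc
    rw [← Finset.sum_add_sum_compl S]
    congr 1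
    refine Finset.sum_congr rfl fun i hi => ?_
    rw [hc i, hθ i (Finset.mem_compl.mp hi), mul_zero, zero_add]
  have hup : score (fun t => 768 * penaltyRate n p t) x v ≤ ∑ i ∈ S, (b * θ i + z i) ^ 2 := by
    refine Finset.sup'_le _ _ fun t ht => ?_
    rw [sparsityScore_eq, hsplit t _ z b hv]
    have h1 := (abs_le.mp (hz t ht)).2
    have h2 : ∑ i ∈ S, thresholded (threshold n p t) (cusum v fun u => x u i)
        ≤ ∑ i ∈ S, (b * θ i + z i) ^ 2 := Finset.sum_le_sum fun i _ => by
      rw [hv i]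
      exact thresholded_le_sq threshold_nonneg _
    linarith
  obtain ⟨t, ht, ht0, htT, hcen, hpen⟩ := exists_grid_near hn hp hS hST
  -- `4622 = 14 + 2 · 768 · 3`: the centring on the support, then the off-support noise and the
  -- penalty, each at most `768 · 3` times the rate.
  have hlow : ∑ i ∈ S, (b' * θ i + z' i) ^ 2 - 4622 * rate n p S.card
      ≤ score (fun t => 768 * penaltyRate n p t) x η := by
    refine le_trans ?_ (Finset.le_sup' _ ht)
    rw [sparsityScore_eq, hsplit t _ z' b' hη]
    have h1 := (abs_le.mp (hz' t ht)).1
    have h2 : ∑ i ∈ S, ((b' * θ i + z' i) ^ 2 - centering (threshold n p t))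
        ≤ ∑ i ∈ S, thresholded (threshold n p t) (cusum η fun u => x u i) :=
      Finset.sum_le_sum fun i _ => by
        rw [hη i]
        exact sq_sub_centering_le_thresholded threshold_nonneg _
    rw [Finset.sum_sub_distrib, Finset.sum_const, nsmul_eq_mul] at h2
    linarith
  -- Twice the cross term returns half of the energy drop. The noise energy at `η` enters with a
  -- favourable sign and is dropped.
  have hdiff := sum_sq_signal_add_noise_sub S θ z z' b b' hθ
  have hz'0 : 0 ≤ ∑ i ∈ S, z' i ^ 2 := Finset.sum_nonneg fun _ _ => sq_nonneg _
  have hL := one_le_logFactor hn hp hS hST.le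
  have hrate := rate_of_lt hST
  have hr1 : S.card * logFactor n p S.card ≤ rate n p S.card := hrate ▸ le_max_left _ _
  have hr2 : Real.log n ≤ rate n p S.card := hrate ▸ le_max_right _ _
  have hr3 : (S.card : ℝ) ≤ S.card * logFactor n p S.card :=
    le_mul_of_one_le_right (by positivity) hL
  have hlog := log_natCast_pos_of_two_le hn
  linarith

/-- On the favourable noise event the score separates candidates from the changepoint: the dense
regime. -/
lemma score_le_of_dense (hn : 2 ≤ n) (hp : 0 < p) {k : ℕ} (hkp : k ≤ p)
    (hkT : √(p * Real.log n) < k) (x : Fin n → EuclideanSpace ℝ (Fin p))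
    {η v : ℕ} (θ z z' : Fin p → ℝ) {b b' : ℝ}
    (hv : ∀ i, (cusum v fun u => x u i) = b * θ i + z i)
    (hη : ∀ i, (cusum η fun u => x u i) = b' * θ i + z' i)
    (hz : ∀ t ∈ sparsityGrid n p,
      |∑ i, thresholded (threshold n p t) (z i)| ≤ 768 * penaltyRate n p t)
    (hz' : ∀ t ∈ sparsityGrid n p,
      |∑ i, thresholded (threshold n p t) (z' i)| ≤ 768 * penaltyRate n p t)
    (hbelow : ∀ t ∈ sparsityGrid n p, -(544 * √(p * logMax n p))
      ≤ ∑ i, belowThreshold (threshold n p t) (b * θ i + z i))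
    (hcross : ∑ i, (b * z i - b' * z' i) * θ i
      ≤ (b' ^ 2 - b ^ 2) * (∑ i, θ i ^ 2) / 4 + 16 * Real.log n) :
    score (fun t => 768 * penaltyRate n p t) x v
      ≤ score (fun t => 768 * penaltyRate n p t) x η
        - (b' ^ 2 - b ^ 2) * (∑ i, θ i ^ 2) / 2 + 5000 * rate n p k := by
  have hlog := log_natCast_pos_of_two_le hn
  have hpT : √(p * Real.log n) < p := hkT.trans_le (by exact_mod_cast hkp)
  have hpmem : p ∈ sparsityGrid n p := Finset.mem_insert_self _ _
  have hk0 : 0 < k := by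
    have : (0 : ℝ) < k := (Real.sqrt_nonneg _).trans_lt hkT
    exact_mod_cast this
  have hr1 := log_le_rate hn hk0 hkp
  have hrate := rate_of_gt hkT
  have hr2 : √(p * Real.log n) ≤ rate n p k := by
    rw [hrate]
    exact Real.sqrt_le_sqrt (mul_le_mul_of_nonneg_left (le_max_left _ _) (by positivity))
  have hup : score (fun t => 768 * penaltyRate n p t) x v
      ≤ ∑ i, (b * θ i + z i) ^ 2 - p + 544 * rate n p k := by
    refine Finset.sup'_le _ _ fun t ht => ?_
    rw [sparsityScore_eq]
    have h1 := hbelow t ht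
    simp only [belowThreshold, Finset.sum_sub_distrib, Finset.sum_const, nsmul_eq_mul, mul_one,
      Finset.card_univ, Fintype.card_fin] at h1
    simp only [hv]
    have h2 : 0 ≤ penaltyRate n p t := by
      have := (abs_nonneg _).trans (hz t ht)
      linarith
    rw [hrate]
    linarith
  -- At `t = p` the threshold is zero, so the noise event is itself a two-sided chi-square bound.
  have hchi : ∀ w : Fin p → ℝ, (∀ t ∈ sparsityGrid n p,
      |∑ i, thresholded (threshold n p t) (w i)| ≤ 768 * penaltyRate n p t) →
      |∑ i, w i ^ 2 - p| ≤ 768 * rate n p k := by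
    intro w hw
    have h := hw p hpmem
    rw [threshold_eq_zero hpT, penaltyRate_of_gt hpT] at h
    simp only [thresholded_zero, Finset.sum_sub_distrib, Finset.sum_const, nsmul_eq_mul, mul_one,
      Finset.card_univ, Fintype.card_fin] at h
    linarith
  have hlow : ∑ i, (b' * θ i + z' i) ^ 2 - p - 768 * rate n p k
      ≤ score (fun t => 768 * penaltyRate n p t) x η := by
    refine le_trans ?_ (Finset.le_sup' _ hpmem)
    rw [sparsityScore_eq, threshold_eq_zero hpT, penaltyRate_of_gt hpT]
    simp only [thresholded_zero, Finset.sum_sub_distrib, Finset.sum_const, nsmul_eq_mul, mul_one,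
      Finset.card_univ, Fintype.card_fin, hη]
    linarith
  have hdiff := sum_sq_signal_add_noise_sub Finset.univ θ z z' b b' (by simp)
  have h1 := (abs_le.mp (hchi z hz)).2
  have h2 := (abs_le.mp (hchi z' hz')).1
  linarith

end Deterministic

lemma prob_ge_of_forall_notMem {Ω : Type*} [MeasurableSpace Ω] {P : Measure Ω}
    [IsProbabilityMeasure P] {n : ℕ} (hn : 2 ≤ n) (B : ℕ → Set Ω)
    (hB : ∀ v ∈ Set.Ioo 0 n, P.real (B v) ≤ 16 * Real.exp (-(8 * Real.log n))) (G : Set Ω)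
    (hG : ∀ ω, (∀ v ∈ Set.Ioo 0 n, ω ∉ B v) → ω ∈ G) : 1 - 1 / (n : ℝ) ≤ P.real G := by
  have hn' : (2 : ℝ) ≤ n := by exact_mod_cast hn
  have hcover : (Set.univ : Set Ω) ⊆ G ∪ ⋃ v ∈ Finset.Ioo 0 n, B v := by
    intro ω _
    by_cases h : ∀ v ∈ Set.Ioo 0 n, ω ∉ B v
    · exact Or.inl (hG ω h)
    · push Not at h
      obtain ⟨v, hv, hω⟩ := h
      right
      simp only [Set.mem_iUnion]
      exact ⟨v, by simpa using hv, hω⟩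
  have h1 : (1 : ℝ) ≤ P.real G + P.real (⋃ v ∈ Finset.Ioo 0 n, B v) := by
    have := (measureReal_mono (μ := P) hcover (measure_ne_top _ _)).trans (measureReal_union_le _ _)
    simpa using this
  have h2 : P.real (⋃ v ∈ Finset.Ioo 0 n, B v) ≤ 1 / n := by
    calc P.real (⋃ v ∈ Finset.Ioo 0 n, B v) ≤ ∑ v ∈ Finset.Ioo 0 n, P.real (B v) :=
          measureReal_biUnion_finset_le _ _
      _ ≤ ∑ v ∈ Finset.Ioo 0 n, 16 * Real.exp (-(8 * Real.log n)) :=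
          Finset.sum_le_sum fun v hv => hB v (by simpa using hv)
      _ ≤ n * (16 * Real.exp (-(8 * Real.log n))) := by
          rw [Finset.sum_const, nsmul_eq_mul]
          gcongr
          simp
      -- One power of `n` is spent on the union over `v`; `n⁶ ≥ 64 > 16` then absorbs the constant.
      _ = 16 / (n : ℝ) ^ 7 := by
          have : Real.exp (8 * Real.log n) = (n : ℝ) ^ 8 := by
            rw [mul_comm, Real.exp_mul, Real.exp_log (by positivity)]
            norm_cast
          rw [Real.exp_neg, this]
          field_simp
      _ ≤ 1 / n := by
          rw [div_le_div_iff₀ (by positivity) (by positivity), one_mul]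
          have : (16 : ℝ) ≤ n ^ 6 := by
            calc (16 : ℝ) ≤ 2 ^ 6 := by norm_num
              _ ≤ n ^ 6 := by gcongr
          calc (16 : ℝ) * n ≤ n ^ 6 * n := by gcongr
            _ = n ^ 7 := by ring
  linarith

/-- Comparison at the maximizer gives `min(|v - η|, Δ) Θ ≤ 4Ch`. Were the minimum `Δ`, this would
contradict `5Ch ≤ ΘΔ`; hence the gap between the constants `4` and `5`. -/
lemma abs_sub_le_of_score_le {n p : ℕ} {η : ℕ} (hη : η ∈ Set.Ioo 0 n) {Θ h C : ℝ} (hΘ : 0 < Θ)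
    (hh : 0 < h) (hC : 0 < C) (hsnr : 5 * C * h ≤ Θ * ((min η (n - η) : ℕ) : ℝ))
    (hn : 2 ≤ n) (pen : ℕ → ℝ) (x : Fin n → EuclideanSpace ℝ (Fin p))
    (hscore : ∀ v ∈ Set.Ioo 0 n, score pen x v ≤ score pen x η
      - (stepCusum n η η ^ 2 - stepCusum n η v ^ 2) * Θ / 2 + C * h) :
    |(estimator pen x : ℝ) - η| ≤ 4 * C / Θ * h := by
  obtain ⟨hv, hmax⟩ := estimator_spec hn pen x
  set v := estimator pen x
  have h1 := hscore v hv
  have h2 := hmax η hη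
  have h3 := half_min_le_stepCusum_sq_sub hv hη
  have h4 : min |(v : ℝ) - η| ((min η (n - η) : ℕ) : ℝ) * Θ ≤ 4 * C * h := by nlinarith
  have hCh : 0 < C * h := by positivity
  rcases le_total |(v : ℝ) - η| ((min η (n - η) : ℕ) : ℝ) with h5 | h5
  · rw [min_eq_left h5] at h4
    rw [div_mul_eq_mul_div, le_div_iff₀ hΘ]
    exact h4
  · rw [min_eq_right h5] at h4
    nlinarith

/-! ### Signal-plus-noise decomposition and assembly of the theorem. -/

section Main

variable {n p : ℕ} {μ : Fin n → EuclideanSpace ℝ (Fin p)} {η : ℕ} {Ω : Type*}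
  {X W : Fin n → Ω → EuclideanSpace ℝ (Fin p)} {σ : ℝ}

/-- The CUSUM of the standardized noise. -/
noncomputable def noiseCusum (σ : ℝ) (W : Fin n → Ω → EuclideanSpace ℝ (Fin p)) (v : ℕ) (ω : Ω)
    (i : Fin p) : ℝ :=
  ∑ t, cusumCoeff v t * ((1 / σ) • W t ω) i

lemma cusum_eq_signal_add_noise (hη : IsSingleChangepoint μ η)
    (hX : ∀ v ω, X v ω = μ v + W v ω) {v : ℕ} (hv : v ∈ Set.Ioo 0 n) (ω : Ω) (i : Fin p) :
    (cusum v fun u => ((1 / σ) • X u ω) i)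
      = stepCusum n η v * ((1 / σ) • hη.jump) i + noiseCusum σ W v ω i := by
  have h := hη.cusum_mean hv i
  rw [cusum_eq_sum, noiseCusum]
  have : ∀ t, cusumCoeff v t * ((1 / σ) • X t ω) i = 1 / σ * (cusumCoeff v t * μ t i)
      + cusumCoeff v t * ((1 / σ) • W t ω) i := by
    intro t
    rw [hX]
    simp only [smul_add, PiLp.add_apply, PiLp.smul_apply, smul_eq_mul]
    ring
  simp_rw [this]
  rw [Finset.sum_add_distrib, ← Finset.mul_sum, h]
  simp only [PiLp.smul_apply, smul_eq_mul]
  ring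

lemma inner_linearCombination_eq (a b : ℝ) (v u : ℕ) (θ : EuclideanSpace ℝ (Fin p)) (ω : Ω) :
    ⟪∑ t : Fin n, (a * cusumCoeff v t - b * cusumCoeff u t) • (1 / σ) • W t ω, θ⟫
      = ∑ i, (a * noiseCusum σ W v ω i - b * noiseCusum σ W u ω i) * θ i := by
  rw [PiLp.inner_apply]
  refine Finset.sum_congr rfl fun i _ => ?_
  rw [show ∀ x y : ℝ, ⟪x, y⟫ = x * y from fun x y => by simp [mul_comm], noiseCusum, noiseCusum, Finset.mul_sum, Finset.mul_sum,
    ← Finset.sum_sub_distrib, WithLp.ofLp_sum, Finset.sum_apply]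
  congr 1
  refine Finset.sum_congr rfl fun t _ => ?_
  simp only [PiLp.smul_apply, smul_eq_mul]
  ring

lemma prob_cross_noise_le [MeasurableSpace Ω] {P : Measure Ω} (hσ : 0 < σ) [IsProbabilityMeasure P] (hind : iIndepFun W P)
    (hlaw : ∀ v, HasLaw (W v)
      (multivariateGaussian 0 (σ ^ 2 • (1 : Matrix (Fin p) (Fin p) ℝ))) P)
    {v : ℕ} (hv : v ∈ Set.Ioo 0 n) (hη : η ∈ Set.Ioo 0 n) (θ : EuclideanSpace ℝ (Fin p)) :
    P.real {ω | (stepCusum n η η ^ 2 - stepCusum n η v ^ 2) * (∑ i, θ i ^ 2) / 4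
        + 16 * Real.log n ≤ ∑ i, (stepCusum n η v * noiseCusum σ W v ω i
          - stepCusum n η η * noiseCusum σ W η ω i) * θ i}
      ≤ Real.exp (-(8 * Real.log n)) := by
  have h := prob_inner_linearCombination_le hσ hind hlaw
    (fun t => stepCusum n η v * cusumCoeff v t - stepCusum n η η * cusumCoeff η t) θ
    (16 * Real.log n)
  simp_rw [sum_sq_stepCusum_mul_sub hv hη, inner_linearCombination_eq,
    EuclideanSpace.real_norm_sq_eq] at h
  refine h.trans (le_of_eq ?_)
  ring_nf

end Main

end MeanChange

theorem theorem1 :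
    ∃ lam₀ C₀ C₁ : ℝ, 0 < lam₀ ∧ 0 < C₀ ∧ 0 < C₁ ∧
      ∀ (n p : ℕ) (μ : Fin n → EuclideanSpace ℝ (Fin p)) (η : ℕ)
        (hη : MeanChange.IsSingleChangepoint μ η) (σ : ℝ),
        0 < σ →
        ∀ (Ω : Type*) [MeasurableSpace Ω] (P : Measure Ω) [IsProbabilityMeasure P]
          (X W : Fin n → Ω → EuclideanSpace ℝ (Fin p)),
          (∀ v ω, X v ω = μ v + W v ω) →
          iIndepFun W P →
          (∀ v, HasLaw (W v)
            (multivariateGaussian 0 (σ ^ 2 • (1 : Matrix (Fin p) (Fin p) ℝ))) P) →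
          ∀ (k Δ : ℕ) (φ : ℝ),
            k = MeanChange.sparsity hη.jump →
            φ = ‖hη.jump‖ →
            Δ = min η (n - η) →
            φ ^ 2 * Δ / σ ^ 2 ≥ C₀ * MeanChange.rate n p k →
            P.real {ω | |((MeanChange.estimator
                (fun t => lam₀ * MeanChange.penaltyRate n p t)
                (fun v => (1 / σ) • X v ω) : ℕ) : ℝ) - η|
                  ≤ C₁ * (σ ^ 2 / φ ^ 2) * MeanChange.rate n p k}
              ≥ 1 - 1 / (n : ℝ) := by
  -- `768` is the multiple of the penalty rate in the noise tail bounds. With the score error `C =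
  -- 5000`, the other two constants are `5C` and `4C`.
  refine ⟨768, 25000, 20000, by norm_num, by norm_num, by norm_num, ?_⟩
  intro n p μ η hη σ hσ Ω _ P _ X W hX hind hlaw k Δ φ hk hφ hΔ hsnr
  open MeanChange in
  have hηI : η ∈ Set.Ioo 0 n := ⟨hη.pos, hη.lt⟩
  have hn : 2 ≤ n := by
    have := hηI.1
    have := hηI.2
    omega
  have hlog := log_natCast_pos_of_two_le hn
  set S : Finset (Fin p) := Finset.univ.filter fun i => hη.jump i ≠ 0 with hSdef
  have hkS : k = S.card := hk
  have hkp : k ≤ p := hkS ▸ card_finset_fin_le S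
  have hk0 : 0 < k := by
    rw [hkS, Finset.card_pos]
    by_contra hcon
    rw [Finset.not_nonempty_iff_eq_empty, Finset.filter_eq_empty_iff] at hcon
    refine hη.jump_ne_zero ?_
    ext i
    simpa using hcon (Finset.mem_univ i)
  have hp : 0 < p := hk0.trans_le hkp
  have hφ0 : 0 < φ := hφ ▸ norm_pos_iff.mpr hη.jump_ne_zero
  have hh : 0 < rate n p k := hlog.trans_le (log_le_rate hn hk0 hkp)
  set θ : EuclideanSpace ℝ (Fin p) := (1 / σ) • hη.jump with hθ
  have hΘ : ∑ i, θ i ^ 2 = φ ^ 2 / σ ^ 2 := by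
    rw [← EuclideanSpace.real_norm_sq_eq, hθ, norm_smul, hφ, mul_pow, Real.norm_eq_abs, sq_abs]
    ring
  have hθS : ∀ i ∉ S, θ i = 0 := by
    intro i hi
    have : hη.jump i = 0 := by simpa [hSdef] using hi
    simp [hθ, this]
  have hZ : ∀ v ∈ Set.Ioo 0 n, HasLaw (noiseCusum σ W v)
      (Measure.pi fun _ : Fin p => gaussianReal 0 1) P := fun v hv =>
    hasLaw_linearCombination hσ hind hlaw (sum_cusumCoeff_sq hv)
  have hcusum : ∀ ω, ∀ v ∈ Set.Ioo 0 n, ∀ i, (cusum v fun u => ((1 / σ) • X u ω) i)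
      = stepCusum n η v * θ i + noiseCusum σ W v ω i := fun ω v hv i =>
    cusum_eq_signal_add_noise hη hX hv ω i
  have hcross := fun v (hv : v ∈ Set.Ioo 0 n) => prob_cross_noise_le hσ hind hlaw hv hηI θ
  have hconclude : ∀ ω, (∀ v ∈ Set.Ioo 0 n,
      score (fun t => 768 * penaltyRate n p t) (fun v => (1 / σ) • X v ω) v
        ≤ score (fun t => 768 * penaltyRate n p t) (fun v => (1 / σ) • X v ω) η
          - (stepCusum n η η ^ 2 - stepCusum n η v ^ 2) * (∑ i, θ i ^ 2) / 2
          + 5000 * rate n p k) →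
      ω ∈ {ω | |((estimator (fun t => 768 * penaltyRate n p t)
        (fun v => (1 / σ) • X v ω) : ℕ) : ℝ) - η| ≤ 20000 * (σ ^ 2 / φ ^ 2) * rate n p k} := by
    intro ω hω
    rw [hΘ] at hω
    have := abs_sub_le_of_score_le hηI (by positivity) hh (by norm_num) (by
      rw [← hΔ]
      calc 5 * 5000 * rate n p k = 25000 * rate n p k := by norm_num
        _ ≤ _ := hsnr
        _ = φ ^ 2 / σ ^ 2 * Δ := by ring) hn _ _ hω
    refine this.trans (le_of_eq ?_)
    field_simp
    norm_num
  rcases lt_or_gt_of_ne (natCast_ne_sqrt_mul_log (n := n) (by omega) p hk0.ne') with hkT | hkT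
  -- The bad events at `v` cost `12 + 1 + 1 ≤ 16` units of `e^{-8 log n}`. The noise at `η` needs no
  -- separate event, since `v = η` is included.
  · refine prob_ge_of_forall_notMem hn (fun v =>
      {ω | ∃ t ∈ sparsityGrid n p, 768 * penaltyRate n p t
        < |∑ i ∈ Sᶜ, thresholded (threshold n p t) (noiseCusum σ W v ω i)|} ∪
      ({ω | 8 / 3 * (S.card + 8 * Real.log n) ≤ ∑ i ∈ S, noiseCusum σ W v ω i ^ 2} ∪
      {ω | (stepCusum n η η ^ 2 - stepCusum n η v ^ 2) * (∑ i, θ i ^ 2) / 4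
        + 16 * Real.log n ≤ ∑ i, (stepCusum n η v * noiseCusum σ W v ω i
          - stepCusum n η η * noiseCusum σ W η ω i) * θ i})) ?_ _ ?_
    · intro v hv
      have h1 := prob_exists_grid_thresholded_sum hn hp (hZ v hv) Sᶜ
      have h2 := prob_sum_sq_ge_le (hZ v hv) S (8 * Real.log n)
      have h3 := hcross v hv
      refine (measureReal_union_le _ _).trans
        ((add_le_add_right (measureReal_union_le _ _) _).trans ?_)
      have := Real.exp_pos (-(8 * Real.log n))
      linarith
    · intro ω hω
      simp only [Set.mem_union, not_or, Set.mem_ofPred_eq, not_exists, not_and, not_lt, not_le]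
        at hω
      refine hconclude ω fun v hv => ?_
      have := score_le_of_sparse hn hp (hkS ▸ hk0) (hkS ▸ hkT) (fun v => (1 / σ) • X v ω) θ
        (noiseCusum σ W v ω) (noiseCusum σ W η ω) hθS (hcusum ω v hv) (hcusum ω η hηI)
        (hω v hv).1 (hω η hηI).1 (hω v hv).2.1.le (hω v hv).2.2.le
      rwa [← hkS] at this
  -- In the dense case the cost is `12 + 3 + 1 = 16` units.
  · refine prob_ge_of_forall_notMem hn (fun v =>
      {ω | ∃ t ∈ sparsityGrid n p, 768 * penaltyRate n p t
        < |∑ i, thresholded (threshold n p t) (noiseCusum σ W v ω i)|} ∪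
      ({ω | ∃ t ∈ sparsityGrid n p, ∑ i, belowThreshold (threshold n p t)
          (stepCusum n η v * θ i + noiseCusum σ W v ω i) ≤ -(544 * √(p * logMax n p))} ∪
      {ω | (stepCusum n η η ^ 2 - stepCusum n η v ^ 2) * (∑ i, θ i ^ 2) / 4
        + 16 * Real.log n ≤ ∑ i, (stepCusum n η v * noiseCusum σ W v ω i
          - stepCusum n η η * noiseCusum σ W η ω i) * θ i})) ?_ _ ?_
    · intro v hv
      have h1 := prob_exists_grid_thresholded_sum hn hp (hZ v hv) Finset.univ
      have h2 := prob_exists_grid_belowThreshold hn hp (le_of_sqrt_lt hn hkp hkT) (hZ v hv)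
        (fun i => stepCusum n η v * θ i)
      have h3 := hcross v hv
      refine (measureReal_union_le _ _).trans
        ((add_le_add_right (measureReal_union_le _ _) _).trans ?_)
      linarith
    · intro ω hω
      simp only [Set.mem_union, not_or, Set.mem_ofPred_eq, not_exists, not_and, not_lt, not_le]
        at hω
      refine hconclude ω fun v hv => ?_
      exact score_le_of_dense hn hp hkp hkT (fun v => (1 / σ) • X v ω) θ
        (noiseCusum σ W v ω) (noiseCusum σ W η ω) (hcusum ω v hv) (hcusum ω η hηI)
        (hω v hv).1 (hω η hηI).1 (fun t ht => ((hω v hv).2.1 t ht).le) (hω v hv).2.2.le
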